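/- For a probability measure $\eta$ on $\mathbb R$ let $F_\eta(x)=\eta((-\infty,x])$, $F_\eta(x_-)=\eta((-\infty,x))$, and $F_\eta^{-1}(u)=\inf\{x: F_\eta(x)\ge u\}$ for $u\in(0,1)$. Let $\mu,\nu$ be probability measures on $\mathbb R$ with finite first moments. Write $\mu\le_{dcx}\nu$ (resp. $\mu\le_{icx}\nu$) if $\int f\,d\mu\le\int f\,d\nu$ (in $(-\infty,+\infty]$) for every nonincreasing (resp. nondecreasing) convex $f:\mathbb R\to\mathbb R$. A measure $M(dx,dy)=\mu(dx)\,m(x,dy)$, with $m$ a Markov kernel, is a supermartingale (resp. submartingale) coupling between $\mu$ and $\nu$ if its marginals are $\mu$ and $\nu$ and, for $\mu$-a.e. $x$, $\int|y|\,m(x,dy)<\infty$ and $\int y\,m(x,dy)\le x$ (resp. $\ge x$). For $u\in[0,1]$ let $\Psi_\pm(u)=\int_0^u(F_\mu^{-1}-F_\nu^{-1})^\pm(v)\,dv$, let $\widetilde\varphi(u)=\inf\{r\in[0,1]:\Psi_+(r)\ge\Psi_-(u)\}$, $u_d=\widetilde\varphi(1)$, $\gamma_d=\Psi_+(u_d)$,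 and for $u\in(0,u_d)$ let $\varphi(u)=\inf\{r\in[0,1]:\Psi_-(r)\ge\Psi_+(u)\}$. If $u_d>0$, let $\mathcal Q^d$ be the set of probability measures $Q$ on $(0,u_d)\times(0,1)$ with first marginal $\frac1{\gamma_d}(F_\mu^{-1}-F_\nu^{-1})^+(u)\,du$, second marginal $\frac1{\gamma_d}(F_\mu^{-1}-F_\nu^{-1})^-(v)\,dv$, and $Q(\{(u,v):u<v\})=1$. Disintegration kernels of $Q\in\mathcal Q^d$ are sub-Markov kernels $\pi_+$ (from $(0,u_d)$ to $(0,1)$) and $\pi_-$ (from $(0,1)$ to $(0,u_d)$) with $$Q(du,dv)=\tfrac1{\gamma_d}(F_\mu^{-1}-F_\nu^{-1})^+(u)\,du\,\pi_+(u,dv)=\tfrac1{\gamma_d}(F_\mu^{-1}-F_\nu^{-1})^-(v)\,dv\,\pi_-(v,du).$$ For a measure $\kappa$ and $u\in(0,1)$ put $$T_u\kappa(dy)=\int\frac{F_\mu^{-1}(u)-F_\nu^{-1}(u)}{F_\nu^{-1}(v)-F_\nu^{-1}(u)}\,\delta_{F_\nu^{-1}(v)}(dy)\,\kappa(dv)+\Big(\int\frac{F_\nu^{-1}(v)-F_\mu^{-1}(u)}{F_\nu^{-1}(v)-F_\nu^{-1}(u)}\,\kappa(dv)\Big)\delta_{F_\nu^{-1}(u)}(dy).$$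 Let $\widetilde m^{Q}(u,\cdot)$ be $T_u\pi_+(u,\cdot)$ if $u<u_d$, $F_\mu^{-1}(u)>F_\nu^{-1}(u)$ and $\pi_+(u,\{v:F_\nu^{-1}(v)>F_\mu^{-1}(u)\})=1$; $T_u\pi_-(u,\cdot)$ if $F_\mu^{-1}(u)<F_\nu^{-1}(u)$ and $\pi_-(u,\{v:F_\nu^{-1}(v)<F_\mu^{-1}(u)\})=1$; and $\delta_{F_\nu^{-1}(u)}$ otherwise. For a kernel $\widetilde m$ on $(0,1)$, let the associated kernel $m$ on $\mathbb R$ be: $m(x,\cdot)=\delta_x$ if $F_\mu(x)=0$ or $F_\mu(x_-)=1$; $m(x,\cdot)=\frac1{\mu(\{x\})}\int_{F_\mu(x_-)}^{F_\mu(x)}\widetilde m(u,\cdot)\,du$ if $\mu(\{x\})>0$; and $m(x,\cdot)=\widetilde m(F_\mu(x),\cdot)$ otherwise. Let $m^Q$ be associated to $\widetilde m^Q$. Finally let $$Q^{ITS}(du,dv)=\tfrac1{\gamma_d}(F_\mu^{-1}-F_\nu^{-1})^+(u)\,du\,\pi^{ITS}_+(u,dv),\qquad \pi_+^{ITS}(u,dv)=\mathbf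 1_{\{0<\varphi(u)<1\}}\delta_{\varphi(u)}(dv),\quad u\in(0,u_d).$$ **Part 1.** Suppose $\mu\le_{dcx}\nu$ and $u_d>0$. (a) Every $Q\in\mathcal Q^d$ admits disintegration kernels and, for every choice of them, $m^Q$ is a Markov kernel and $\mu(dx)\,m^Q(x,dy)$ is a supermartingale coupling between $\mu$ and $\nu$. (b) $Q^{ITS}\in\mathcal Q^d$. Moreover $Q^{ITS}(du,dv)=\frac1{\gamma_d}(F_\mu^{-1}-F_\nu^{-1})^-(v)\,dv\,\pi_-^{ITS}(v,du)$ with $\pi_-^{ITS}(v,du)=\mathbf 1_{\{0<\widetilde\varphi(v)<u_d\}}\delta_{\widetilde\varphi(v)}(du)$. (c) With the disintegration kernels $\pi^{ITS}_\pm$, $\widetilde m^{Q^{ITS}}(u,\cdot)$ equals, for all $u\in(0,1)$: $(1-p)\,\delta_{F_\nu^{-1}(u)}+p\,\delta_{F_\nu^{-1}(\varphi(u))}$ with $p=\frac{F_\mu^{-1}(u)-F_\nu^{-1}(u)}{F_\nu^{-1}(\varphi(u))-F_\nu^{-1}(u)}$ if $u<u_d$, $\varphi(u)<1$ and $F_\nu^{-1}(\varphi(u))>F_\mu^{-1}(u)>F_\nu^{-1}(u)$;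 $(1-q)\,\delta_{F_\nu^{-1}(u)}+q\,\delta_{F_\nu^{-1}(\widetilde\varphi(u))}$ with $q=\frac{F_\nu^{-1}(u)-F_\mu^{-1}(u)}{F_\nu^{-1}(u)-F_\nu^{-1}(\widetilde\varphi(u))}$ if $\widetilde\varphi(u)<u_d$ and $F_\nu^{-1}(\widetilde\varphi(u))<F_\mu^{-1}(u)<F_\nu^{-1}(u)$; and $\delta_{F_\nu^{-1}(u)}$ otherwise. The associated measure $\mu(dx)\,m^{Q^{ITS}}(x,dy)$ is a supermartingale coupling between $\mu$ and $\nu$ (the inverse transform supermartingale coupling). **Part 2.** Suppose $\mu\le_{icx}\nu$, and let $\bar\mu,\bar\nu$ be the images of $\mu,\nu$ under $x\mapsto-x$. Then $\bar\mu\le_{dcx}\bar\nu$, and for every supermartingale coupling $M$ between $\bar\mu$ and $\bar\nu$ the image of $M$ under $(x,y)\mapsto(-x,-y)$ is a submartingale coupling between $\mu$ and $\nu$. In particular, if the number $u_d$ associated with $(\bar\mu,\bar\nu)$ is positive, this holds for $\bar\mu(dx)\,m^Q(x,dy)$, for every $Q$ in the set $\mathcal Q^d$ associated with $(\bar\mu,\bar\nu)$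 and every choice of the disintegration kernels, and for the inverse transform supermartingale coupling between $\bar\mu$ and $\bar\nu$. -/

import Mathlib

open MeasureTheory ProbabilityTheory Set

noncomputable section

namespace ITCoupling

/-! ### Quantile functions and stochastic orders -/

/-- The quantile function `F_μ⁻¹(u) = inf {x | F_μ(x) ≥ u}`, meaningful for `u ∈ (0,1)`. -/
def quantile (μ : Measure ℝ) (u : ℝ) : ℝ := sInf {x : ℝ | u ≤ cdf μ x}

/-- Decreasing convex order on laws with finite first moment: `∫ f dμ ≤ ∫ f dν` for every
nonincreasing convex `f`. The negative part of a convex `f` is integrable against such laws, so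
both integrals are well defined in `(-∞, +∞]`; the inequality is trivial when the right-hand side
is `+∞`, and otherwise it says that the left-hand side is finite and at most the right-hand side. -/
def DcxLE (μ ν : Measure ℝ) : Prop :=
  ∀ f : ℝ → ℝ, Antitone f → ConvexOn ℝ univ f → Integrable f ν →
    Integrable f μ ∧ ∫ x, f x ∂μ ≤ ∫ x, f x ∂ν

/-- Increasing convex order: `∫ f dμ ≤ ∫ f dν` (in `(-∞, +∞]`) for every nondecreasing
convex `f`. -/
def IcxLE (μ ν : Measure ℝ) : Prop :=
  ∀ f : ℝ → ℝ, Monotone f → ConvexOn ℝ univ f → Integrable f ν →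
    Integrable f μ ∧ ∫ x, f x ∂μ ≤ ∫ x, f x ∂ν

/-! ### Super- and submartingale couplings -/

/-- `M` is a coupling between `μ` and `ν`. -/
structure IsCoupling (M : Measure (ℝ × ℝ)) (μ ν : Measure ℝ) : Prop where
  fst_eq : M.map Prod.fst = μ
  snd_eq : M.map Prod.snd = ν

/-- `M(dx,dy) = μ(dx) m(x,dy)` is a coupling between `μ` and `ν` such that, for `μ`-almost every
`x`, `∫ |y| m(x,dy) < ∞` and `∫ y m(x,dy) ≤ x`. -/
structure IsSupermartingaleCoupling (M : Measure (ℝ × ℝ)) (μ ν : Measure ℝ) : Prop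
    extends IsCoupling M μ ν where
  exists_kernel : ∃ m : Kernel ℝ ℝ, IsMarkovKernel m ∧ M = μ ⊗ₘ m ∧
    ∀ᵐ x ∂μ, Integrable (fun y : ℝ => y) (m x) ∧ ∫ y, y ∂(m x) ≤ x

/-- `M(dx,dy) = μ(dx) m(x,dy)` is a coupling between `μ` and `ν` such that, for `μ`-almost every
`x`, `∫ |y| m(x,dy) < ∞` and `∫ y m(x,dy) ≥ x`. -/
structure IsSubmartingaleCoupling (M : Measure (ℝ × ℝ)) (μ ν : Measure ℝ) : Prop
    extends IsCoupling M μ ν where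
  exists_kernel : ∃ m : Kernel ℝ ℝ, IsMarkovKernel m ∧ M = μ ⊗ₘ m ∧
    ∀ᵐ x ∂μ, Integrable (fun y : ℝ => y) (m x) ∧ x ≤ ∫ y, y ∂(m x)

/-! ### The functions `Ψ₊`, `Ψ₋`, `φ`, `φ̃` and the constants `u_d`, `γ_d` -/

/-- `(F_μ⁻¹ - F_ν⁻¹)⁺`. -/
def gapPos (μ ν : Measure ℝ) (u : ℝ) : ℝ := max (quantile μ u - quantile ν u) 0

/-- `(F_μ⁻¹ - F_ν⁻¹)⁻`. -/
def gapNeg (μ ν : Measure ℝ) (u : ℝ) : ℝ := max (-(quantile μ u - quantile ν u)) 0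

/-- `Ψ₊(u) = ∫₀ᵘ (F_μ⁻¹ - F_ν⁻¹)⁺(v) dv`. -/
def PsiPlus (μ ν : Measure ℝ) (u : ℝ) : ℝ := ∫ v in (0 : ℝ)..u, gapPos μ ν v

/-- `Ψ₋(u) = ∫₀ᵘ (F_μ⁻¹ - F_ν⁻¹)⁻(v) dv`. -/
def PsiMinus (μ ν : Measure ℝ) (u : ℝ) : ℝ := ∫ v in (0 : ℝ)..u, gapNeg μ ν v

/-- `φ = Ψ₋⁻¹ ∘ Ψ₊`, with the left-continuous generalised inverse. It is only used where the set
is non-empty. -/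
def phi (μ ν : Measure ℝ) (u : ℝ) : ℝ :=
  sInf {r : ℝ | r ∈ Icc (0 : ℝ) 1 ∧ PsiPlus μ ν u ≤ PsiMinus μ ν r}

/-- `φ̃ = Ψ₊⁻¹ ∘ Ψ₋`, with the left-continuous generalised inverse. -/
def phiTilde (μ ν : Measure ℝ) (u : ℝ) : ℝ :=
  sInf {r : ℝ | r ∈ Icc (0 : ℝ) 1 ∧ PsiMinus μ ν u ≤ PsiPlus μ ν r}

/-- `u_d = φ̃(1)`. -/
def uD (μ ν : Measure ℝ) : ℝ := phiTilde μ ν 1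

/-- `γ_d = ∫₀^{u_d} (F_μ⁻¹ - F_ν⁻¹)⁺(u) du`. -/
def gammaD (μ ν : Measure ℝ) : ℝ := ∫ u in (0 : ℝ)..uD μ ν, gapPos μ ν u

/-- The measure `γ_d⁻¹ (F_μ⁻¹ - F_ν⁻¹)⁺(u) du` on `(0, u_d)`. -/
def rhoPlus (μ ν : Measure ℝ) : Measure ℝ :=
  (volume.restrict (Ioo 0 (uD μ ν))).withDensity
    fun u => ENNReal.ofReal (1 / gammaD μ ν * gapPos μ ν u)

/-- The measure `γ_d⁻¹ (F_μ⁻¹ - F_ν⁻¹)⁻(v) dv` on `(0, 1)`. -/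
def rhoMinus (μ ν : Measure ℝ) : Measure ℝ :=
  (volume.restrict (Ioo 0 1)).withDensity
    fun v => ENNReal.ofReal (1 / gammaD μ ν * gapNeg μ ν v)

/-! ### The set `𝒬^d` and the kernels -/

/-- Membership in the set `𝒬^d` of probability measures on `(0, u_d) × (0, 1)` (seen as measures
on `ℝ × ℝ` concentrated there). -/
structure IsQd (μ ν : Measure ℝ) (Q : Measure (ℝ × ℝ)) : Prop where
  prob : IsProbabilityMeasure Q
  fst_eq : Q.map Prod.fst = rhoPlus μ ν
  snd_eq : Q.map Prod.snd = rhoMinus μ ν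
  lt_ae : Q {p : ℝ × ℝ | p.1 ∈ Ioo 0 (uD μ ν) ∧ p.2 ∈ Ioo (0 : ℝ) 1 ∧ p.1 < p.2} = 1

/-- The set `𝒬^d`. -/
def Qd (μ ν : Measure ℝ) : Set (Measure (ℝ × ℝ)) := {Q | IsQd μ ν Q}

/-- `πp = π₊` and `πm = π₋` are sub-Markov kernels (with values in the measures on `(0,1)`, resp.
on `(0,u_d)`) such that
`Q(du,dv) = γ_d⁻¹ (F_μ⁻¹ - F_ν⁻¹)⁺(u) du π₊(u,dv) = γ_d⁻¹ (F_μ⁻¹ - F_ν⁻¹)⁻(v) dv π₋(v,du)`. -/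
structure IsDisintegration (μ ν : Measure ℝ) (Q : Measure (ℝ × ℝ)) (πp πm : Kernel ℝ ℝ) :
    Prop where
  plus_le : ∀ u, πp u univ ≤ 1
  plus_supp : ∀ u, πp u (Ioo (0 : ℝ) 1)ᶜ = 0
  minus_le : ∀ v, πm v univ ≤ 1
  minus_supp : ∀ v, πm v (Ioo 0 (uD μ ν))ᶜ = 0
  eq_plus : Q = rhoPlus μ ν ⊗ₘ πp
  eq_minus : Q = (rhoMinus μ ν ⊗ₘ πm).map Prod.swap

/-- The measure
`∫ (F_μ⁻¹(u) - F_ν⁻¹(u)) / (F_ν⁻¹(v) - F_ν⁻¹(u)) δ_{F_ν⁻¹(v)}(dy) κ(dv)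
  + (∫ (F_ν⁻¹(v) - F_μ⁻¹(u)) / (F_ν⁻¹(v) - F_ν⁻¹(u)) κ(dv)) δ_{F_ν⁻¹(u)}(dy)`. -/
def mixture (μ ν : Measure ℝ) (u : ℝ) (κ : Measure ℝ) : Measure ℝ :=
  (κ.withDensity fun v => ENNReal.ofReal
      ((quantile μ u - quantile ν u) / (quantile ν v - quantile ν u))).map (quantile ν)
    + (∫⁻ v, ENNReal.ofReal
        ((quantile ν v - quantile μ u) / (quantile ν v - quantile ν u)) ∂κ)
      • Measure.dirac (quantile ν u)

open Classical in
/-- The kernel `m̃^Q(u, dy)`, `u ∈ (0,1)`, built from `π₊` and `π₋`. -/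
def mTilde (μ ν : Measure ℝ) (πp πm : Kernel ℝ ℝ) (u : ℝ) : Measure ℝ :=
  if quantile ν u < quantile μ u ∧ u ∈ Ioo 0 (uD μ ν) ∧
      πp u {v | v ∈ Ioo (0 : ℝ) 1 ∧ quantile μ u < quantile ν v} = 1 then
    mixture μ ν u (πp u)
  else if quantile μ u < quantile ν u ∧ u ∈ Ioo (0 : ℝ) 1 ∧
      πm u {v | v ∈ Ioo (0 : ℝ) 1 ∧ quantile ν v < quantile μ u} = 1 then
    mixture μ ν u (πm u)
  else Measure.dirac (quantile ν u)

open Classical in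
/-- The kernel `m(x, dy)`, `x ∈ ℝ`, built from a kernel `m̃(u, dy)`, `u ∈ (0,1)`:
`δ_x` if `F_μ(x) = 0` or `F_μ(x₋) = 1`; `μ({x})⁻¹ ∫_{F_μ(x₋)}^{F_μ(x)} m̃(u, dy) du` if
`μ({x}) > 0`; `m̃(F_μ(x), dy)` otherwise. -/
def grandM (μ : Measure ℝ) (mt : ℝ → Measure ℝ) (x : ℝ) : Measure ℝ :=
  if cdf μ x = 0 ∨ Function.leftLim (cdf μ) x = 1 then Measure.dirac x
  else if 0 < μ {x} then
    (μ {x})⁻¹ • (volume.restrict (Ioc (Function.leftLim (cdf μ) x) (cdf μ x))).bind mt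
  else mt (cdf μ x)

/-! ### The inverse transform case -/

/-- `Q^{ITS}(du,dv) = γ_d⁻¹ (F_μ⁻¹ - F_ν⁻¹)⁺(u) du 1_{0 < φ(u) < 1} δ_{φ(u)}(dv)` on
`(0,u_d) × (0,1)`, written as the image of `1_{0 < φ(u) < 1} γ_d⁻¹ (F_μ⁻¹ - F_ν⁻¹)⁺(u) du` by
`u ↦ (u, φ(u))`. -/
def QITS (μ ν : Measure ℝ) : Measure (ℝ × ℝ) :=
  ((rhoPlus μ ν).restrict {u | 0 < phi μ ν u ∧ phi μ ν u < 1}).map fun u => (u, phi μ ν u)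

open Classical in
/-- `π₊^{ITS}(u,dv) = 1_{0 < φ(u) < 1} δ_{φ(u)}(dv)` for `u ∈ (0,u_d)`, extended by zero. -/
def piITSPlus (μ ν : Measure ℝ) (u : ℝ) : Measure ℝ :=
  if u ∈ Ioo 0 (uD μ ν) ∧ 0 < phi μ ν u ∧ phi μ ν u < 1 then Measure.dirac (phi μ ν u) else 0

open Classical in
/-- `π₋^{ITS}(v,du) = 1_{0 < φ̃(v) < u_d} δ_{φ̃(v)}(du)` for `v ∈ (0,1)`, extended by zero. -/
def piITSMinus (μ ν : Measure ℝ) (v : ℝ) : Measure ℝ :=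
  if v ∈ Ioo (0 : ℝ) 1 ∧ 0 < phiTilde μ ν v ∧ phiTilde μ ν v < uD μ ν then
    Measure.dirac (phiTilde μ ν v) else 0

open Classical in
/-- The explicit form of `m̃^{Q^{ITS}}(u, dy)`, `u ∈ (0,1)`. -/
def mTildeITS (μ ν : Measure ℝ) (u : ℝ) : Measure ℝ :=
  if u < uD μ ν ∧ quantile μ u < quantile ν (phi μ ν u) ∧ quantile ν u < quantile μ u ∧
      phi μ ν u < 1 then
    ENNReal.ofReal (1 - (quantile μ u - quantile ν u) / (quantile ν (phi μ ν u) - quantile ν u))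
        • Measure.dirac (quantile ν u)
      + ENNReal.ofReal
          ((quantile μ u - quantile ν u) / (quantile ν (phi μ ν u) - quantile ν u))
        • Measure.dirac (quantile ν (phi μ ν u))
  else if quantile ν (phiTilde μ ν u) < quantile μ u ∧ quantile μ u < quantile ν u ∧
      phiTilde μ ν u < uD μ ν then
    ENNReal.ofReal
          (1 - (quantile ν u - quantile μ u) / (quantile ν u - quantile ν (phiTilde μ ν u)))
        • Measure.dirac (quantile ν u)
      + ENNReal.ofReal
          ((quantile ν u - quantile μ u) / (quantile ν u - quantile ν (phiTilde μ ν u)))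
        • Measure.dirac (quantile ν (phiTilde μ ν u))
  else Measure.dirac (quantile ν u)

/-- The image of a law on `ℝ` by `x ↦ -x`. -/
def reflect (μ : Measure ℝ) : Measure ℝ := μ.map fun x => -x

/-- The image of a law on `ℝ × ℝ` by `(x, y) ↦ (-x, -y)`. -/
def reflect₂ (M : Measure (ℝ × ℝ)) : Measure (ℝ × ℝ) := M.map fun p => (-p.1, -p.2)

end ITCoupling

end

open ITCoupling

namespace ITCoupling

open Filter Topology

variable {μ ν : Measure ℝ} {u v x : ℝ}

/-! ### Quantile functions -/

/-! Write a and b for the quantile functions of μ and ν, here and in the comments below. Everything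
is done on (0,1) with Lebesgue measure, whose images under a and b are μ and ν. If a Markov kernel k
on (0,1) satisfies ∫ k(u,·) du = ν and has barycentre at most a(u) for almost every u, the image of
du k(u,dy) under (u,y) ↦ (a(u),y) is a supermartingale coupling. Its kernel from μ averages k over
the jump interval of the distribution function at an atom, and is k(F_μ(x),·) elsewhere
(`map_compProd_eq_compProd_grandKernel`, `isSupermartingaleCoupling_grandKernel`).

It remains to see that m̃^Q is such a kernel. Start from u ↦ δ_{b(u)}, which transports Lebesgue
measure to ν. For Q-almost every pair (u,v), u < v gives b(u) < a(u) ≤ a(v) < b(v) (`IsQd.ae_lt`).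
At u a fraction of mass is moved from b(u) to b(v) so that the barycentre becomes a(u); at v a
fraction is moved from b(v) to b(u) so that it becomes a(v). Both transfers have intensity γ_d
Q(du,dv) / (b(v) - b(u)), so they compensate and the second marginal is still ν (`mTilde_apply_add`,
`lintegral_mTilde`). Almost every point with a < b takes part in the exchange; where no exchange
occurs the barycentre b(u) is therefore at most a(u) almost everywhere (`ae_integral_mTilde_le`).

For the inverse transform coupling, testing the order on x ↦ (K - x)⁺ gives Ψ₋ ≤ Ψ₊ on [0,1],
strictly where a > b. Hence φ = Ψ₋⁻¹ ∘ Ψ₊ satisfies u < φ(u) there. Since Ψ₊ and Ψ₋ carry their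
densities to Lebesgue measure on (0, γ_d), φ carries one marginal to the other, with almost
everywhere inverse φ̃ (`DcxPair.map_phi`, `DcxPair.ae_phiTilde_phi`).

The increasing order reduces to the decreasing one under x ↦ -x, which reverses the barycentre
inequality. -/

lemma quantile_le_iff (hu : u ∈ Ioo (0 : ℝ) 1) : quantile μ u ≤ x ↔ u ≤ cdf μ x := by
  have hbdd : BddBelow {x : ℝ | u ≤ cdf μ x} := by
    obtain ⟨y, hy⟩ := ((tendsto_cdf_atBot μ).eventually (gt_mem_nhds hu.1)).exists
    refine ⟨y, fun z hz => ?_⟩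
    by_contra h
    exact absurd (hz.trans (monotone_cdf μ (not_le.1 h).le)) (not_le.2 hy)
  have hne : {x : ℝ | u ≤ cdf μ x}.Nonempty := by
    obtain ⟨y, hy⟩ := ((tendsto_cdf_atTop μ).eventually (lt_mem_nhds hu.2)).exists
    exact ⟨y, hy.le⟩
  constructor
  -- Right continuity of the distribution function makes the infimum attained.
  · intro h
    have hlim : Tendsto (cdf μ) (𝓝[>] x) (𝓝 (cdf μ x)) :=
      ((cdf μ).right_continuous x).mono_left (nhdsWithin_mono _ Ioi_subset_Ici_self)
    refine ge_of_tendsto hlim ?_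
    filter_upwards [self_mem_nhdsWithin] with y hy
    obtain ⟨z, hz, hzy⟩ := exists_lt_of_csInf_lt hne (lt_of_le_of_lt h hy)
    exact le_trans hz (monotone_cdf μ hzy.le)
  · intro h
    exact csInf_le hbdd h

lemma lt_quantile_iff (hu : u ∈ Ioo (0 : ℝ) 1) : x < quantile μ u ↔ cdf μ x < u := by
  rw [← not_le, quantile_le_iff hu, not_le]

lemma monotoneOn_quantile : MonotoneOn (quantile μ) (Ioo 0 1) := fun _ hu _ hv huv =>
  (quantile_le_iff hu).2 (huv.trans ((quantile_le_iff hv).1 le_rfl))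

/-- Default value: `sInf univ = 0`, and likewise `sInf ∅ = 0` beyond 1. Both quantile functions thus
vanish outside [0,1], which makes the gaps integrable on the whole line. -/
lemma quantile_of_nonpos (hu : u ≤ 0) : quantile μ u = 0 := by
  have : {x : ℝ | u ≤ cdf μ x} = univ := eq_univ_of_forall fun x => hu.trans (cdf_nonneg μ x)
  simp [quantile, this]

lemma quantile_of_one_lt (hu : 1 < u) : quantile μ u = 0 := by
  have : {x : ℝ | u ≤ cdf μ x} = ∅ :=
    eq_empty_of_forall_notMem fun x hx => absurd (hx.trans (cdf_le_one μ x)) (not_le.2 hu)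
  simp [quantile, this]

lemma measurable_quantile (μ : Measure ℝ) : Measurable (quantile μ) := by
  classical
  have h1 : Measurable ((Ioo (0 : ℝ) 1).indicator (quantile μ)) := by
    refine measurable_of_Iic fun x => ?_
    by_cases hx : 0 ≤ x
    · have : (Ioo (0 : ℝ) 1).indicator (quantile μ) ⁻¹' Iic x
          = (Ioo 0 1 ∩ Iic (cdf μ x)) ∪ (Ioo 0 1)ᶜ := by
        ext u
        by_cases hu : u ∈ Ioo (0 : ℝ) 1
        · simp only [mem_preimage, indicator_of_mem hu, mem_Iic, quantile_le_iff hu]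
          simp [hu]
        · simp only [mem_preimage, indicator_of_notMem hu, mem_Iic]
          simp [hu, hx]
      rw [this]
      exact (measurableSet_Ioo.inter measurableSet_Iic).union measurableSet_Ioo.compl
    · have : (Ioo (0 : ℝ) 1).indicator (quantile μ) ⁻¹' Iic x = Ioo 0 1 ∩ Iic (cdf μ x) := by
        ext u
        by_cases hu : u ∈ Ioo (0 : ℝ) 1
        · simp only [mem_preimage, indicator_of_mem hu, mem_Iic, quantile_le_iff hu]
          simp [hu]
        · simp only [mem_preimage, indicator_of_notMem hu, mem_Iic]
          simp [hu, hx]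
      rw [this]
      exact measurableSet_Ioo.inter measurableSet_Iic
  -- Only at `u = 1` can the quantile differ from its truncation to (0,1).
  refine h1.measurable_of_countable_ne ((countable_singleton (1 : ℝ)).mono fun u hu => ?_)
  by_contra hne
  refine hu ?_
  by_cases hu' : u ∈ Ioo (0 : ℝ) 1
  · rw [indicator_of_mem hu']
  · rw [indicator_of_notMem hu']
    rcases le_or_gt u 0 with h0 | h0
    · rw [quantile_of_nonpos h0]
    · rw [quantile_of_one_lt (lt_of_le_of_ne (not_lt.1 fun h => hu' ⟨h0, h⟩) (Ne.symm hne))]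

instance isProbabilityMeasure_volume_Ioo :
    IsProbabilityMeasure ((volume : Measure ℝ).restrict (Ioo 0 1)) :=
  ⟨by simp⟩

lemma map_quantile (μ : Measure ℝ) [IsProbabilityMeasure μ] :
    (volume.restrict (Ioo (0 : ℝ) 1)).map (quantile μ) = μ := by
  have : IsProbabilityMeasure ((volume.restrict (Ioo (0 : ℝ) 1)).map (quantile μ)) :=
    Measure.isProbabilityMeasure_map (measurable_quantile μ).aemeasurable
  refine Measure.ext_of_Iic _ _ fun x => ?_
  rw [Measure.map_apply (measurable_quantile μ) measurableSet_Iic,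
    Measure.restrict_apply (measurable_quantile μ measurableSet_Iic)]
  have : quantile μ ⁻¹' Iic x ∩ Ioo 0 1 = Ioo 0 1 ∩ Iic (cdf μ x) := by
    ext u
    constructor
    · rintro ⟨h, hu⟩
      exact ⟨hu, (quantile_le_iff hu).1 h⟩
    · rintro ⟨hu, h⟩
      exact ⟨(quantile_le_iff hu).2 h, hu⟩
  rw [this, ← ofReal_cdf]
  have h' : (Ioo (0 : ℝ) 1 ∩ Iic (cdf μ x) : Set ℝ) =ᵐ[volume] Ioc 0 (cdf μ x) := by
    have h1 : (Ioo (0 : ℝ) 1 : Set ℝ) =ᵐ[volume] Ioc 0 1 := Ioo_ae_eq_Ioc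
    refine (h1.inter (ae_eq_refl _)).trans (Eq.eventuallyEq (Set.ext fun u => ?_))
    simp only [mem_inter_iff, mem_Ioc, mem_Iic]
    exact ⟨fun h => ⟨h.1.1, h.2⟩, fun h => ⟨⟨h.1, h.2.trans (cdf_le_one μ x)⟩, h.2⟩⟩
  rw [measure_congr h', Real.volume_Ioc, sub_zero]

lemma integrable_quantile [IsProbabilityMeasure μ] (hμ : Integrable (fun x : ℝ => x) μ) :
    Integrable (quantile μ) (volume.restrict (Ioo 0 1)) := by
  rw [← map_quantile μ] at hμ
  exact (integrable_map_measure aestronglyMeasurable_id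
    (measurable_quantile μ).aemeasurable).1 hμ

lemma integral_comp_quantile [IsProbabilityMeasure μ] {f : ℝ → ℝ} (hf : Measurable f) :
    ∫ u in Ioo (0 : ℝ) 1, f (quantile μ u) = ∫ x, f x ∂μ := by
  conv_rhs => rw [← map_quantile μ]
  rw [integral_map (measurable_quantile μ).aemeasurable hf.aestronglyMeasurable]

/-- Test the order on f(x) = (K - x)⁺ with K = b(u). By monotonicity (K - b)⁺ is K - b on (0,u] and
0 after u, while (K - a)⁺ only dominates K - a on (0,u]. The constant K then cancels. -/
lemma DcxLE.setIntegral_quantile_le [IsProbabilityMeasure μ] [IsProbabilityMeasure ν]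
    (hμ : Integrable (fun x : ℝ => x) μ) (hν : Integrable (fun x : ℝ => x) ν)
    (h : DcxLE μ ν) (hu : u ∈ Ioo (0 : ℝ) 1) :
    ∫ v in Ioc 0 u, quantile ν v ≤ ∫ v in Ioc 0 u, quantile μ v := by
  set K := quantile ν u with hK
  set f : ℝ → ℝ := fun x => max (K - x) 0 with hf
  have hfm : Measurable f := by fun_prop
  have hanti : Antitone f := fun x y hxy => max_le_max (by linarith) le_rfl
  have hconv : ConvexOn ℝ univ f := by
    refine ConvexOn.sup ?_ (convexOn_const 0 convex_univ)
    exact (convexOn_const K convex_univ).sub (concaveOn_id convex_univ)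
  have hfν : Integrable f ν := ((integrable_const K).sub hν).pos_part
  have hle := (h f hanti hconv hfν).2
  have hsub : Ioc (0 : ℝ) u ⊆ Ioo 0 1 := fun v hv => ⟨hv.1, hv.2.trans_lt hu.2⟩
  have ia := integrable_quantile hμ
  have ib := integrable_quantile hν
  have ia' : IntegrableOn (quantile μ) (Ioc 0 u) := IntegrableOn.mono_set ia hsub
  have ib' : IntegrableOn (quantile ν) (Ioc 0 u) := IntegrableOn.mono_set ib hsub
  have ic : IntegrableOn (fun _ : ℝ => K) (Ioc 0 u) := by simp [integrableOn_const_iff]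
  have e1 : ∫ v in Ioo (0 : ℝ) 1, f (quantile ν v) = ∫ v in Ioc 0 u, (K - quantile ν v) := by
    rw [← integral_indicator measurableSet_Ioo, ← integral_indicator measurableSet_Ioc]
    congr 1
    ext v
    by_cases hv : v ∈ Ioo (0 : ℝ) 1
    · rw [indicator_of_mem hv]
      rcases le_or_gt v u with hvu | hvu
      · rw [indicator_of_mem (show v ∈ Ioc 0 u from ⟨hv.1, hvu⟩)]
        exact max_eq_left (sub_nonneg.2 (monotoneOn_quantile hv hu hvu))
      · rw [indicator_of_notMem (fun h => absurd h.2 (not_le.2 hvu))]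
        exact max_eq_right (sub_nonpos.2 (monotoneOn_quantile hu hv hvu.le))
    · rw [indicator_of_notMem hv, indicator_of_notMem fun h => hv (hsub h)]
  have e2 : ∫ v in Ioc 0 u, (K - quantile μ v) ≤ ∫ v in Ioo (0 : ℝ) 1, f (quantile μ v) := by
    have i2 : IntegrableOn (fun v => f (quantile μ v)) (Ioo 0 1) :=
      ((integrable_const K).sub ia).pos_part
    refine (setIntegral_mono (ic.sub ia') (i2.mono_set hsub) fun v => le_max_left _ _).trans ?_
    exact setIntegral_mono_set i2 (ae_of_all _ fun v => le_max_right _ _) hsub.eventuallyLE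
  rw [← integral_comp_quantile hfm, ← integral_comp_quantile hfm, e1] at hle
  have := e2.trans hle
  rw [integral_sub ic ia', integral_sub ic ib'] at this
  linarith

/-! ### Left-continuous inverses of primitives of densities -/

/-- The left-continuous inverse on `[0,1]` of a nondecreasing function. -/
noncomputable def leftInv (Φ : ℝ → ℝ) (t : ℝ) : ℝ := sInf {r : ℝ | r ∈ Icc (0 : ℝ) 1 ∧ t ≤ Φ r}

section LeftInv

variable {Φ : ℝ → ℝ} {t c : ℝ}

lemma leftInv_mem (hΦ : Continuous Φ) (ht : t ≤ Φ 1) :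
    leftInv Φ t ∈ Icc (0 : ℝ) 1 ∧ t ≤ Φ (leftInv Φ t) := by
  have hcl : IsClosed {r : ℝ | r ∈ Icc (0 : ℝ) 1 ∧ t ≤ Φ r} :=
    isClosed_Icc.inter (isClosed_le continuous_const hΦ)
  exact hcl.csInf_mem ⟨1, ⟨zero_le_one, le_rfl⟩, ht⟩ ⟨0, fun r hr => hr.1.1⟩

lemma leftInv_le_iff (hΦ : Continuous Φ) (hm : Monotone Φ) (ht : t ≤ Φ 1) (hc : c ∈ Icc (0 : ℝ) 1) :
    leftInv Φ t ≤ c ↔ t ≤ Φ c :=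
  ⟨fun h => (leftInv_mem hΦ ht).2.trans (hm h), fun h => csInf_le ⟨0, fun _ hr => hr.1.1⟩ ⟨hc, h⟩⟩

lemma apply_leftInv (hΦ : Continuous Φ) (hm : Monotone Φ) (h0 : Φ 0 = 0) (ht0 : 0 ≤ t)
    (ht : t ≤ Φ 1) : Φ (leftInv Φ t) = t := by
  obtain ⟨hmem, hle⟩ := leftInv_mem hΦ ht
  refine le_antisymm ?_ hle
  obtain ⟨r, hr, hrt⟩ := intermediate_value_Icc hmem.1 hΦ.continuousOn
    (show t ∈ Icc (Φ 0) (Φ (leftInv Φ t)) from ⟨h0.le.trans ht0, hle⟩)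
  have := (leftInv_le_iff hΦ hm ht ⟨hr.1, hr.2.trans hmem.2⟩).2 hrt.ge
  exact (hm this).trans hrt.le

lemma measurable_leftInv (hΦ : Continuous Φ) (hm : Monotone Φ) : Measurable (leftInv Φ) := by
  -- Above `Φ 1` the defining set is empty and `sInf` returns 0, so the preimage of `Iic c` with 0 ≤
  -- c ≤ 1 also contains `Ioi (Φ 1)`.
  have hjunk : ∀ t, ¬ t ≤ Φ 1 → leftInv Φ t = 0 := by
    intro t ht
    have : {r : ℝ | r ∈ Icc (0 : ℝ) 1 ∧ t ≤ Φ r} = ∅ :=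
      eq_empty_of_forall_notMem fun r hr => ht (hr.2.trans (hm hr.1.2))
    rw [leftInv, this, Real.sInf_empty]
  have hmem : ∀ t, leftInv Φ t ∈ Icc (0 : ℝ) 1 := by
    intro t
    by_cases ht : t ≤ Φ 1
    · exact (leftInv_mem hΦ ht).1
    · simp [hjunk t ht]
  refine measurable_of_Iic fun c => ?_
  rcases lt_or_ge c 0 with hc0 | hc0
  · have : leftInv Φ ⁻¹' Iic c = ∅ :=
      eq_empty_of_forall_notMem fun t ht => absurd ((hmem t).1.trans ht) (not_le.2 hc0)
    simp [this]
  rcases le_or_gt c 1 with hc1 | hc1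
  · have : leftInv Φ ⁻¹' Iic c = Iic (Φ c) ∪ Ioi (Φ 1) := by
      ext t
      simp only [mem_preimage, mem_Iic, mem_union, mem_Ioi]
      by_cases ht : t ≤ Φ 1
      · rw [leftInv_le_iff hΦ hm ht ⟨hc0, hc1⟩]
        simp [ht]
      · simp [hjunk t ht, hc0, not_le.1 ht]
    rw [this]
    exact measurableSet_Iic.union measurableSet_Ioi
  · have : leftInv Φ ⁻¹' Iic c = univ :=
      eq_univ_of_forall fun t => (hmem t).2.trans hc1.le
    simp [this]

end LeftInv

/-- The measure `g(u) du` on `(0, e)`. -/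
noncomputable def densityOn (g : ℝ → ℝ) (e : ℝ) : Measure ℝ :=
  (volume.restrict (Ioo 0 e)).withDensity fun u => ENNReal.ofReal (g u)

/-! ### Primitives of nonnegative densities as transports to Lebesgue measure -/

section Primitive

variable {g : ℝ → ℝ} {e s : ℝ}

lemma monotone_primitive (hg : Integrable g) (hg0 : 0 ≤ g) : Monotone fun u => ∫ v in (0 : ℝ)..u, g v := by
  intro x y hxy
  have := intervalIntegral.integral_add_adjacent_intervals (a := 0) (b := x) (c := y)
    hg.intervalIntegrable hg.intervalIntegrable
  have h2 := intervalIntegral.integral_nonneg (μ := volume) hxy fun u _ => hg0 u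
  simp only
  linarith

lemma continuous_primitive (hg : Integrable g) : Continuous fun u => ∫ v in (0 : ℝ)..u, g v :=
  intervalIntegral.continuous_primitive (fun _ _ => hg.intervalIntegrable) 0

lemma densityOn_Ici (hg : Integrable g) (hg0 : 0 ≤ g) (hs : 0 ≤ s) (hse : s ≤ e) :
    densityOn g e (Ici s) = ENNReal.ofReal ((∫ v in (0 : ℝ)..e, g v) - ∫ v in (0 : ℝ)..s, g v) := by
  rw [densityOn, withDensity_apply _ measurableSet_Ici, Measure.restrict_restrict measurableSet_Ici]
  have : (Ici s ∩ Ioo 0 e : Set ℝ) =ᵐ[volume] Ioc s e := by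
    have h1 : (Ioo 0 e : Set ℝ) =ᵐ[volume] Ioc 0 e := Ioo_ae_eq_Ioc
    have h2 : (Ici s : Set ℝ) =ᵐ[volume] Ioi s := Ioi_ae_eq_Ici.symm
    refine (h2.inter h1).trans (Eq.eventuallyEq (Set.ext fun u => ?_))
    simp only [mem_inter_iff, mem_Ioc, mem_Ioi]
    exact ⟨fun h => ⟨h.1, h.2.2⟩, fun h => ⟨h.1, hs.trans_lt h.1, h.2⟩⟩
  rw [Measure.restrict_congr_set this, intervalIntegral.integral_interval_sub_left
    hg.intervalIntegrable hg.intervalIntegrable, intervalIntegral.integral_of_le hse,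
    ofReal_integral_eq_lintegral_ofReal hg.integrableOn (ae_of_all _ hg0)]

lemma isFiniteMeasure_densityOn (hg : Integrable g) : IsFiniteMeasure (densityOn g e) :=
  isFiniteMeasure_withDensity_ofReal hg.integrableOn.2

lemma ae_densityOn_mem : ∀ᵐ u ∂(densityOn g e), u ∈ Ioo 0 e :=
  (withDensity_absolutelyContinuous _ _).ae_le (ae_restrict_mem measurableSet_Ioo)

lemma densityOn_univ (hg : Integrable g) (hg0 : 0 ≤ g) (he : 0 ≤ e) :
    densityOn g e univ = ENNReal.ofReal (∫ v in (0 : ℝ)..e, g v) := by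
  have h := densityOn_Ici hg hg0 le_rfl he
  rw [intervalIntegral.integral_same, sub_zero] at h
  rw [← h]
  refine measure_congr ?_
  filter_upwards [ae_densityOn_mem (g := g) (e := e)] with u hu
  exact propext ⟨fun _ => hu.1.le, fun _ => trivial⟩

/-- Probability integral transform for an unnormalised density, with flat pieces of Φ allowed.
Half-lines `Ici t` suffice, because {t ≤ Φ} is again a half-line, starting at the left inverse of t.
-/
lemma map_primitive_densityOn (hg : Integrable g) (hg0 : 0 ≤ g) (he : e ∈ Icc (0 : ℝ) 1) :
    (densityOn g e).map (fun u => ∫ v in (0 : ℝ)..u, g v)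
      = volume.restrict (Ioo 0 (∫ v in (0 : ℝ)..e, g v)) := by
  set Φ : ℝ → ℝ := fun u => ∫ v in (0 : ℝ)..u, g v with hΦdef
  have hc : Continuous Φ := continuous_primitive hg
  have hm : Monotone Φ := monotone_primitive hg hg0
  have h0 : Φ 0 = 0 := intervalIntegral.integral_same
  have := isFiniteMeasure_densityOn (e := e) hg
  refine Measure.ext_of_Ici _ _ fun t => ?_
  rw [Measure.map_apply hc.measurable measurableSet_Ici]
  -- The starting point s is 0, the left inverse of t, or e, according to whether t ≤ 0, 0 < t ≤
  -- Φ(e), or Φ(e) < t.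
  obtain ⟨s, hs, hst, hvol⟩ : ∃ s ∈ Icc 0 e, (∀ u ∈ Ioo 0 e, t ≤ Φ u ↔ s ≤ u) ∧
      volume.restrict (Ioo 0 (Φ e)) (Ici t) = ENNReal.ofReal (Φ e - Φ s) := by
    rcases le_or_gt t 0 with ht0 | ht0
    · refine ⟨0, ⟨le_rfl, he.1⟩, fun u hu => ⟨fun _ => hu.1.le, fun _ => ?_⟩, ?_⟩
      · exact ht0.trans (h0.symm.le.trans (hm hu.1.le))
      · rw [Measure.restrict_apply measurableSet_Ici, inter_eq_self_of_subset_right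
          (show Ioo 0 (Φ e) ⊆ Ici t from fun u hu => ht0.trans hu.1.le), Real.volume_Ioo, h0]
    rcases le_or_gt t (Φ e) with hte | hte
    · have ht1 : t ≤ Φ 1 := hte.trans (hm he.2)
      refine ⟨leftInv Φ t, ⟨(leftInv_mem hc ht1).1.1, (leftInv_le_iff hc hm ht1 he).2 hte⟩,
        fun u hu => (leftInv_le_iff hc hm ht1 ⟨hu.1.le, hu.2.le.trans he.2⟩).symm, ?_⟩
      rw [apply_leftInv hc hm h0 ht0.le ht1, Measure.restrict_apply measurableSet_Ici]
      have : Ici t ∩ Ioo 0 (Φ e) = Ico t (Φ e) := by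
        ext u
        exact ⟨fun h => ⟨h.1, h.2.2⟩, fun h => ⟨h.1, ht0.trans_le h.1, h.2⟩⟩
      rw [this, Real.volume_Ico]
    · refine ⟨e, ⟨he.1, le_rfl⟩, fun u hu => ⟨fun h => ?_, fun h => ?_⟩, ?_⟩
      · exact absurd (h.trans (hm hu.2.le)) (not_le.2 hte)
      · exact absurd hu.2 (not_lt.2 h)
      · rw [Measure.restrict_apply measurableSet_Ici]
        have : Ici t ∩ Ioo 0 (Φ e) = ∅ :=
          eq_empty_of_forall_notMem fun u hu => absurd (hu.2.2.trans hte) (not_lt.2 hu.1)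
        simp [this]
  rw [hvol, ← densityOn_Ici hg hg0 hs.1 hs.2]
  refine measure_congr ?_
  filter_upwards [ae_densityOn_mem (g := g) (e := e)] with u hu
  exact propext (hst u hu)

/-- If the left inverse of Φ(u) is below u, then Φ is flat on an interval ending at u that contains
a rational q, so Φ(u) = Φ(q). Only countably many values arise in this way, and each has a null
preimage because the image measure is Lebesgue. -/
lemma ae_leftInv_primitive (hg : Integrable g) (hg0 : 0 ≤ g) (he : e ∈ Icc (0 : ℝ) 1) :
    ∀ᵐ u ∂(densityOn g e),
      leftInv (fun u => ∫ v in (0 : ℝ)..u, g v) (∫ v in (0 : ℝ)..u, g v) = u := by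
  set Φ : ℝ → ℝ := fun u => ∫ v in (0 : ℝ)..u, g v with hΦdef
  have hc : Continuous Φ := continuous_primitive hg
  have hm : Monotone Φ := monotone_primitive hg hg0
  have hq : ∀ᵐ u ∂(densityOn g e), ∀ q : ℚ, Φ u ≠ Φ q := by
    refine ae_all_iff.2 fun q => ?_
    have h : ∀ᵐ t ∂((densityOn g e).map Φ), t ≠ Φ q := by
      rw [map_primitive_densityOn hg hg0 he]
      exact Measure.ae_ne _ _
    exact ae_of_ae_map hc.measurable.aemeasurable h
  filter_upwards [hq, ae_densityOn_mem (g := g) (e := e)] with u hu hmem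
  have hu01 : u ∈ Icc (0 : ℝ) 1 := ⟨hmem.1.le, hmem.2.le.trans he.2⟩
  have hle : leftInv Φ (Φ u) ≤ u := (leftInv_le_iff hc hm (hm hu01.2) hu01).2 le_rfl
  refine le_antisymm hle (not_lt.1 fun hlt => ?_)
  obtain ⟨q, hq1, hq2⟩ := exists_rat_btwn hlt
  exact hu q (le_antisymm ((leftInv_mem hc (hm hu01.2)).2.trans (hm hq1.le)) (hm hq2.le))

end Primitive

/-! ### The functions `Ψ₊`, `Ψ₋` and the couplings of their densities -/

section Psi

variable {μ ν : Measure ℝ} {u v : ℝ}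

lemma gapNeg_eq (μ ν : Measure ℝ) : gapNeg μ ν = gapPos ν μ := by
  ext u
  simp [gapNeg, gapPos]

/-- Exchanging the laws turns Ψ₋ into Ψ₊, so each fact about primitives is proved once and used for
both. -/
lemma PsiMinus_eq (μ ν : Measure ℝ) : PsiMinus μ ν = PsiPlus ν μ := by
  ext u
  simp [PsiMinus, PsiPlus, gapNeg_eq]

lemma gapPos_nonneg (μ ν : Measure ℝ) : 0 ≤ gapPos μ ν := fun _ => le_max_right _ _

lemma measurable_gapPos (μ ν : Measure ℝ) : Measurable (gapPos μ ν) :=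
  ((measurable_quantile μ).sub (measurable_quantile ν)).max measurable_const

/-- A strict gap persists to the left: b only decreases there, and a stays above a level c < a(u) on
(F_μ(c), u]. The bound u/2 keeps s positive. -/
lemma exists_lt_gapPos_pos (hu : u ∈ Ioo (0 : ℝ) 1) (h : quantile ν u < quantile μ u) :
    ∃ s ∈ Ioo 0 u, ∀ v ∈ Ioc s u, quantile ν v < quantile μ v := by
  obtain ⟨c, hc1, hc2⟩ := exists_between h
  have hc := (lt_quantile_iff hu).1 hc2
  refine ⟨max (cdf μ c) (u / 2), ⟨lt_max_of_lt_right (half_pos hu.1),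
    max_lt hc (half_lt_self hu.1)⟩, fun v hv => ?_⟩
  have hv0 : 0 < v := (half_pos hu.1).trans ((le_max_right _ _).trans_lt hv.1)
  have hv1 : v ∈ Ioo (0 : ℝ) 1 := ⟨hv0, hv.2.trans_lt hu.2⟩
  exact ((monotoneOn_quantile hv1 hu hv.2).trans_lt hc1).trans
    ((lt_quantile_iff hv1).2 ((le_max_left _ _).trans_lt hv.1))

variable [IsProbabilityMeasure μ] [IsProbabilityMeasure ν]

lemma integrable_gapPos (hμ : Integrable (fun x : ℝ => x) μ) (hν : Integrable (fun x : ℝ => x) ν) :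
    Integrable (gapPos μ ν) := by
  have h : IntegrableOn (gapPos μ ν) (Ioo 0 1) :=
    ((integrable_quantile hμ).sub (integrable_quantile hν)).pos_part
  have h1 := h.integrable_indicator measurableSet_Ioo
  refine h1.congr ?_
  filter_upwards [Measure.ae_ne volume (1 : ℝ)] with u hu
  by_cases hmem : u ∈ Ioo (0 : ℝ) 1
  · rw [indicator_of_mem hmem]
  · rw [indicator_of_notMem hmem]
    rcases le_or_gt u 0 with h0 | h0
    · simp [gapPos, quantile_of_nonpos h0]
    · have : 1 < u := lt_of_le_of_ne (not_lt.1 fun h => hmem ⟨h0, h⟩) hu.symm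
      simp [gapPos, quantile_of_one_lt this]

lemma continuous_PsiPlus (hμ : Integrable (fun x : ℝ => x) μ)
    (hν : Integrable (fun x : ℝ => x) ν) : Continuous (PsiPlus μ ν) :=
  continuous_primitive (integrable_gapPos hμ hν)

lemma monotone_PsiPlus (hμ : Integrable (fun x : ℝ => x) μ)
    (hν : Integrable (fun x : ℝ => x) ν) : Monotone (PsiPlus μ ν) :=
  monotone_primitive (integrable_gapPos hμ hν) (gapPos_nonneg μ ν)

lemma PsiPlus_zero (μ ν : Measure ℝ) : PsiPlus μ ν 0 = 0 := intervalIntegral.integral_same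

lemma DcxLE.Psi_le (hμ : Integrable (fun x : ℝ => x) μ) (hν : Integrable (fun x : ℝ => x) ν)
    (h : DcxLE μ ν) (hu : u ∈ Icc (0 : ℝ) 1) : PsiPlus ν μ u ≤ PsiPlus μ ν u := by
  have hIoo : ∀ u ∈ Ioo (0 : ℝ) 1, PsiPlus ν μ u ≤ PsiPlus μ ν u := by
    intro u hu
    have hsub : Ioc (0 : ℝ) u ⊆ Ioo 0 1 := fun v hv => ⟨hv.1, hv.2.trans_lt hu.2⟩
    have ia : IntegrableOn (quantile μ) (Ioc 0 u) :=
      IntegrableOn.mono_set (integrable_quantile hμ) hsub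
    have ib : IntegrableOn (quantile ν) (Ioc 0 u) :=
      IntegrableOn.mono_set (integrable_quantile hν) hsub
    have h1 := h.setIntegral_quantile_le hμ hν hu
    have h2 : PsiPlus μ ν u - PsiPlus ν μ u = ∫ v in Ioc 0 u, (quantile μ v - quantile ν v) := by
      simp only [PsiPlus]
      rw [intervalIntegral.integral_of_le hu.1.le, intervalIntegral.integral_of_le hu.1.le,
        ← integral_sub (integrable_gapPos hμ hν).integrableOn
          (integrable_gapPos hν hμ).integrableOn]
      refine integral_congr_ae (ae_of_all _ fun v => ?_)
      simp only [gapPos]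
      rcases le_total (quantile μ v) (quantile ν v) with h | h
      · rw [max_eq_right (by linarith), max_eq_left (by linarith)]; ring
      · rw [max_eq_left (by linarith), max_eq_right (by linarith)]; ring
    rw [integral_sub ia ib] at h2
    linarith
  -- The quantile comparison is available only for 0 < u < 1; continuity adds the endpoints, and u =
  -- 1 is what defines u_d.
  have hcl : IsClosed {u | PsiPlus ν μ u ≤ PsiPlus μ ν u} :=
    isClosed_le (continuous_PsiPlus hν hμ) (continuous_PsiPlus hμ hν)
  have := hcl.closure_subset_iff.2 hIoo
  rw [closure_Ioo zero_ne_one] at this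
  exact this hu

/-- On an interval to the left of u where a > b, Ψ₊ strictly increases while Ψ₋ is constant. -/
lemma PsiPlus_pos (hμ : Integrable (fun x : ℝ => x) μ) (hν : Integrable (fun x : ℝ => x) ν)
    (hu : u ∈ Ioo (0 : ℝ) 1) (h : quantile ν u < quantile μ u) :
    ∃ s ∈ Ioo 0 u, PsiPlus μ ν s < PsiPlus μ ν u ∧ PsiPlus ν μ s = PsiPlus ν μ u := by
  obtain ⟨s, hs, hsv⟩ := exists_lt_gapPos_pos hu h
  refine ⟨s, hs, ?_, ?_⟩
  · have hi := integrable_gapPos hμ hν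
    have h1 := intervalIntegral.integral_interval_sub_left (a := 0) (b := u) (c := s)
      hi.intervalIntegrable hi.intervalIntegrable
    have h2 : 0 < ∫ v in s..u, gapPos μ ν v :=
      intervalIntegral.intervalIntegral_pos_of_pos_on hi.intervalIntegrable
        (fun v hv => lt_max_of_lt_left (sub_pos.2 (hsv v ⟨hv.1, hv.2.le⟩))) hs.2
    simp only [PsiPlus]
    linarith
  · have hi := integrable_gapPos hν hμ
    have h1 := intervalIntegral.integral_interval_sub_left (a := 0) (b := u) (c := s)
      hi.intervalIntegrable hi.intervalIntegrable
    have h2 : ∫ v in s..u, gapPos ν μ v = 0 := by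
      rw [intervalIntegral.integral_of_le hs.2.le]
      refine setIntegral_eq_zero_of_forall_eq_zero fun v hv => ?_
      exact max_eq_right (sub_nonpos.2 (hsv v hv).le)
    simp only [PsiPlus]
    linarith

lemma PsiPlus_pos_of_lt (hμ : Integrable (fun x : ℝ => x) μ) (hν : Integrable (fun x : ℝ => x) ν)
    (hu : u ∈ Ioo (0 : ℝ) 1) (h : quantile ν u < quantile μ u) : 0 < PsiPlus μ ν u := by
  obtain ⟨s, hs, h1, -⟩ := PsiPlus_pos hμ hν hu h
  exact ((PsiPlus_zero μ ν).symm.le.trans (monotone_PsiPlus hμ hν hs.1.le)).trans_lt h1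

/-- With s slightly to the left of u, Ψ₋(u) = Ψ₋(s) ≤ Ψ₊(s) < Ψ₊(u). This strictness is what yields
u < φ(u). -/
lemma DcxLE.Psi_lt (hμ : Integrable (fun x : ℝ => x) μ) (hν : Integrable (fun x : ℝ => x) ν)
    (hdcx : DcxLE μ ν) (hu : u ∈ Ioo (0 : ℝ) 1) (h : quantile ν u < quantile μ u) :
    PsiPlus ν μ u < PsiPlus μ ν u := by
  obtain ⟨s, hs, h1, h2⟩ := PsiPlus_pos hμ hν hu h
  exact (h2.symm.le.trans
    (hdcx.Psi_le hμ hν ⟨hs.1.le, hs.2.le.trans hu.2.le⟩)).trans_lt h1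

end Psi

/-! ### The two marginals prescribed for the elements of 𝒬^d -/

section Rho

variable {μ ν : Measure ℝ} {u v : ℝ}

lemma phi_eq (μ ν : Measure ℝ) (u : ℝ) : phi μ ν u = leftInv (PsiPlus ν μ) (PsiPlus μ ν u) := by
  rw [phi, PsiMinus_eq, leftInv]

lemma phiTilde_eq (μ ν : Measure ℝ) (u : ℝ) :
    phiTilde μ ν u = leftInv (PsiPlus μ ν) (PsiPlus ν μ u) := by
  rw [phiTilde, PsiMinus_eq, leftInv]

lemma rhoPlus_eq (μ ν : Measure ℝ) :
    rhoPlus μ ν = ENNReal.ofReal (1 / gammaD μ ν) • densityOn (gapPos μ ν) (uD μ ν) := by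
  have hm : Measurable fun u => ENNReal.ofReal (gapPos μ ν u) :=
    (measurable_gapPos μ ν).ennreal_ofReal
  rw [rhoPlus, densityOn, ← withDensity_smul _ hm]
  congr 1
  ext u
  simp [ENNReal.ofReal_mul' (gapPos_nonneg μ ν u)]

lemma rhoMinus_eq (μ ν : Measure ℝ) :
    rhoMinus μ ν = ENNReal.ofReal (1 / gammaD μ ν) • densityOn (gapPos ν μ) 1 := by
  have hm : Measurable fun u => ENNReal.ofReal (gapPos ν μ u) :=
    (measurable_gapPos ν μ).ennreal_ofReal
  rw [rhoMinus, densityOn, ← withDensity_smul _ hm]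
  congr 1
  ext u
  simp [gapNeg_eq, ENNReal.ofReal_mul' (gapPos_nonneg ν μ u)]

lemma ae_rhoPlus_of_ae {p : ℝ → Prop} (h : ∀ᵐ u ∂(densityOn (gapPos μ ν) (uD μ ν)), p u) :
    ∀ᵐ u ∂(rhoPlus μ ν), p u := by
  rw [rhoPlus_eq]
  exact Measure.ae_smul_measure h _

lemma ae_rhoMinus_of_ae {p : ℝ → Prop} (h : ∀ᵐ u ∂(densityOn (gapPos ν μ) 1), p u) :
    ∀ᵐ u ∂(rhoMinus μ ν), p u := by
  rw [rhoMinus_eq]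
  exact Measure.ae_smul_measure h _

lemma ae_densityOn_gapPos_lt {e : ℝ} :
    ∀ᵐ u ∂(densityOn (gapPos μ ν) e), quantile ν u < quantile μ u := by
  rw [densityOn, ae_withDensity_iff (measurable_gapPos μ ν).ennreal_ofReal]
  refine ae_of_all _ fun u hu => ?_
  have h : 0 < gapPos μ ν u := by simpa [pos_iff_ne_zero] using hu
  by_contra hle
  exact h.ne' (max_eq_right (sub_nonpos.2 (not_lt.1 hle)))

lemma ae_rhoPlus_lt (μ ν : Measure ℝ) : ∀ᵐ u ∂(rhoPlus μ ν), quantile ν u < quantile μ u :=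
  ae_rhoPlus_of_ae ae_densityOn_gapPos_lt

lemma ae_rhoMinus_lt (μ ν : Measure ℝ) : ∀ᵐ u ∂(rhoMinus μ ν), quantile μ u < quantile ν u :=
  ae_rhoMinus_of_ae ae_densityOn_gapPos_lt

lemma ae_rhoPlus_mem (μ ν : Measure ℝ) : ∀ᵐ u ∂(rhoPlus μ ν), u ∈ Ioo 0 (uD μ ν) :=
  ae_rhoPlus_of_ae ae_densityOn_mem

lemma ae_rhoMinus_mem (μ ν : Measure ℝ) : ∀ᵐ u ∂(rhoMinus μ ν), u ∈ Ioo (0 : ℝ) 1 :=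
  ae_rhoMinus_of_ae ae_densityOn_mem

end Rho

/-- Two laws with finite first moment in the decreasing convex order, for which `u_d > 0`. -/
structure DcxPair (μ ν : Measure ℝ) : Prop where
  prob_left : IsProbabilityMeasure μ
  prob_right : IsProbabilityMeasure ν
  integrable_left : Integrable (fun x : ℝ => x) μ
  integrable_right : Integrable (fun x : ℝ => x) ν
  dcx : DcxLE μ ν
  uD_pos : 0 < uD μ ν

/-! ### Consequences of the order: u_d, the maps φ and φ̃, and Q^{ITS} -/

namespace DcxPair

variable {μ ν : Measure ℝ} {u v : ℝ}

lemma integrable_gapPos_left (h : DcxPair μ ν) : Integrable (gapPos μ ν) := by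
  have := h.prob_left; have := h.prob_right
  exact integrable_gapPos h.integrable_left h.integrable_right

lemma integrable_gapPos_right (h : DcxPair μ ν) : Integrable (gapPos ν μ) := by
  have := h.prob_left; have := h.prob_right
  exact integrable_gapPos h.integrable_right h.integrable_left

lemma continuous_left (h : DcxPair μ ν) : Continuous (PsiPlus μ ν) :=
  continuous_primitive h.integrable_gapPos_left

lemma continuous_right (h : DcxPair μ ν) : Continuous (PsiPlus ν μ) :=
  continuous_primitive h.integrable_gapPos_right

lemma monotone_left (h : DcxPair μ ν) : Monotone (PsiPlus μ ν) :=
  monotone_primitive h.integrable_gapPos_left (gapPos_nonneg _ _)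

lemma monotone_right (h : DcxPair μ ν) : Monotone (PsiPlus ν μ) :=
  monotone_primitive h.integrable_gapPos_right (gapPos_nonneg _ _)

lemma nonneg_left (h : DcxPair μ ν) (hu : 0 ≤ u) : 0 ≤ PsiPlus μ ν u :=
  (PsiPlus_zero μ ν).symm.le.trans (h.monotone_left hu)

lemma nonneg_right (h : DcxPair μ ν) (hu : 0 ≤ u) : 0 ≤ PsiPlus ν μ u :=
  (PsiPlus_zero ν μ).symm.le.trans (h.monotone_right hu)

lemma Psi_le (h : DcxPair μ ν) (hu : u ∈ Icc (0 : ℝ) 1) : PsiPlus ν μ u ≤ PsiPlus μ ν u := by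
  have := h.prob_left; have := h.prob_right
  exact h.dcx.Psi_le h.integrable_left h.integrable_right hu

lemma Psi_lt (h : DcxPair μ ν) (hu : u ∈ Ioo (0 : ℝ) 1) (hlt : quantile ν u < quantile μ u) :
    PsiPlus ν μ u < PsiPlus μ ν u := by
  have := h.prob_left; have := h.prob_right
  exact h.dcx.Psi_lt h.integrable_left h.integrable_right hu hlt

lemma right_pos (h : DcxPair μ ν) (hu : u ∈ Ioo (0 : ℝ) 1) (hlt : quantile μ u < quantile ν u) :
    0 < PsiPlus ν μ u := by
  have := h.prob_left; have := h.prob_right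
  exact PsiPlus_pos_of_lt h.integrable_right h.integrable_left hu hlt

lemma right_one_le (h : DcxPair μ ν) : PsiPlus ν μ 1 ≤ PsiPlus μ ν 1 :=
  h.Psi_le ⟨zero_le_one, le_rfl⟩

lemma uD_eq (μ ν : Measure ℝ) : uD μ ν = leftInv (PsiPlus μ ν) (PsiPlus ν μ 1) := phiTilde_eq μ ν 1

lemma uD_mem (h : DcxPair μ ν) : uD μ ν ∈ Icc (0 : ℝ) 1 := by
  rw [uD_eq]
  exact (leftInv_mem h.continuous_left h.right_one_le).1

lemma mem_of_mem (h : DcxPair μ ν) (hu : u ∈ Ioo 0 (uD μ ν)) : u ∈ Ioo (0 : ℝ) 1 :=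
  ⟨hu.1, hu.2.trans_le h.uD_mem.2⟩

lemma PsiPlus_uD (h : DcxPair μ ν) : PsiPlus μ ν (uD μ ν) = PsiPlus ν μ 1 := by
  rw [uD_eq]
  exact apply_leftInv h.continuous_left h.monotone_left (PsiPlus_zero μ ν)
    (h.nonneg_right zero_le_one) h.right_one_le

lemma gammaD_eq (h : DcxPair μ ν) : gammaD μ ν = PsiPlus ν μ 1 := h.PsiPlus_uD

lemma left_lt_of_lt_uD (h : DcxPair μ ν) (hu : u ∈ Icc (0 : ℝ) 1) :
    u < uD μ ν ↔ PsiPlus μ ν u < PsiPlus ν μ 1 := by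
  rw [← not_le, ← not_le, not_iff_not, uD_eq,
    leftInv_le_iff h.continuous_left h.monotone_left h.right_one_le hu]

lemma gammaD_pos (h : DcxPair μ ν) : 0 < gammaD μ ν := by
  rw [h.gammaD_eq, ← PsiPlus_zero μ ν, ← h.left_lt_of_lt_uD ⟨le_rfl, zero_le_one⟩]
  exact h.uD_pos

lemma ofReal_gammaD_mul (h : DcxPair μ ν) :
    ENNReal.ofReal (1 / gammaD μ ν) * ENNReal.ofReal (gammaD μ ν) = 1 := by
  rw [← ENNReal.ofReal_mul (by have := h.gammaD_pos; positivity),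
    one_div_mul_cancel h.gammaD_pos.ne', ENNReal.ofReal_one]

lemma isProbabilityMeasure_rhoPlus (h : DcxPair μ ν) : IsProbabilityMeasure (rhoPlus μ ν) := by
  refine ⟨?_⟩
  rw [rhoPlus_eq, Measure.smul_apply, densityOn_univ h.integrable_gapPos_left (gapPos_nonneg _ _)
    h.uD_pos.le, smul_eq_mul]
  exact h.ofReal_gammaD_mul

lemma isProbabilityMeasure_rhoMinus (h : DcxPair μ ν) : IsProbabilityMeasure (rhoMinus μ ν) := by
  refine ⟨?_⟩
  rw [rhoMinus_eq, Measure.smul_apply, densityOn_univ h.integrable_gapPos_right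
    (gapPos_nonneg _ _) zero_le_one, smul_eq_mul, ← h.ofReal_gammaD_mul, h.gammaD_eq]
  rfl

lemma measurable_phi (h : DcxPair μ ν) : Measurable (phi μ ν) := by
  have : phi μ ν = leftInv (PsiPlus ν μ) ∘ PsiPlus μ ν := funext (phi_eq μ ν)
  rw [this]
  exact (measurable_leftInv h.continuous_right h.monotone_right).comp h.continuous_left.measurable

lemma measurable_phiTilde (h : DcxPair μ ν) : Measurable (phiTilde μ ν) := by
  have : phiTilde μ ν = leftInv (PsiPlus μ ν) ∘ PsiPlus ν μ := funext (phiTilde_eq μ ν)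
  rw [this]
  exact (measurable_leftInv h.continuous_left h.monotone_left).comp h.continuous_right.measurable

lemma PsiPlus_phi (h : DcxPair μ ν) (hu : u ∈ Ioo 0 (uD μ ν)) :
    PsiPlus ν μ (phi μ ν u) = PsiPlus μ ν u := by
  rw [phi_eq]
  exact apply_leftInv h.continuous_right h.monotone_right (PsiPlus_zero ν μ)
    (h.nonneg_left hu.1.le)
    ((h.left_lt_of_lt_uD (Ioo_subset_Icc_self (h.mem_of_mem hu))).1 hu.2).le

lemma PsiPlus_phiTilde (h : DcxPair μ ν) (hv : v ∈ Ioo (0 : ℝ) 1) :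
    PsiPlus μ ν (phiTilde μ ν v) = PsiPlus ν μ v := by
  rw [phiTilde_eq]
  exact apply_leftInv h.continuous_left h.monotone_left (PsiPlus_zero μ ν)
    (h.nonneg_right hv.1.le) ((h.monotone_right hv.2.le).trans h.right_one_le)

/-- Ψ₋(u) < Ψ₊(u) = Ψ₋(φ(u)), and Ψ₋ is nondecreasing. -/
lemma lt_phi (h : DcxPair μ ν) (hu : u ∈ Ioo 0 (uD μ ν)) (hlt : quantile ν u < quantile μ u) :
    u < phi μ ν u := by
  have h1 := h.Psi_lt (h.mem_of_mem hu) hlt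
  rw [← h.PsiPlus_phi hu] at h1
  exact h.monotone_right.reflect_lt h1

lemma phiTilde_pos (h : DcxPair μ ν) (hv : v ∈ Ioo (0 : ℝ) 1)
    (hlt : quantile μ v < quantile ν v) : 0 < phiTilde μ ν v := by
  have h1 := h.right_pos hv hlt
  rw [← h.PsiPlus_phiTilde hv, ← PsiPlus_zero μ ν] at h1
  exact h.monotone_left.reflect_lt h1

/-- Before normalisation, Ψ₊ sends the first density and Ψ₋ the second to Lebesgue measure on the
same interval, because Ψ₊(u_d) = Ψ₋(1). The left inverse of Ψ₋ then undoes Ψ₋ almost everywhere. -/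
lemma map_phi (h : DcxPair μ ν) : (rhoPlus μ ν).map (phi μ ν) = rhoMinus μ ν := by
  have hphi : phi μ ν = leftInv (PsiPlus ν μ) ∘ PsiPlus μ ν := funext (phi_eq μ ν)
  have hinv := measurable_leftInv h.continuous_right h.monotone_right
  have e1 : (densityOn (gapPos μ ν) (uD μ ν)).map (PsiPlus μ ν)
      = (densityOn (gapPos ν μ) 1).map (PsiPlus ν μ) := by
    have h1 := map_primitive_densityOn h.integrable_gapPos_left (gapPos_nonneg μ ν) h.uD_mem
    have h2 := map_primitive_densityOn h.integrable_gapPos_right (gapPos_nonneg ν μ)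
      (e := 1) ⟨zero_le_one, le_rfl⟩
    have h3 := h.PsiPlus_uD
    simp only [PsiPlus] at h3
    rw [h3] at h1
    exact h1.trans h2.symm
  rw [rhoPlus_eq, rhoMinus_eq, Measure.map_smul, hphi,
    ← Measure.map_map hinv h.continuous_left.measurable, e1,
    Measure.map_map hinv h.continuous_right.measurable]
  congr 1
  have := ae_leftInv_primitive h.integrable_gapPos_right (gapPos_nonneg ν μ)
    (e := 1) ⟨zero_le_one, le_rfl⟩
  exact (Measure.map_congr (g := id) this).trans Measure.map_id

/-- Since Ψ₋(φ(u)) = Ψ₊(u), applying φ̃ leaves Ψ₊⁻¹(Ψ₊(u)). Through this inversion all statements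
about φ̃ follow from those about φ. -/
lemma ae_phiTilde_phi (h : DcxPair μ ν) : ∀ᵐ u ∂(rhoPlus μ ν), phiTilde μ ν (phi μ ν u) = u := by
  have h1 := ae_rhoPlus_of_ae (ae_leftInv_primitive h.integrable_gapPos_left (gapPos_nonneg μ ν)
    h.uD_mem)
  filter_upwards [h1, ae_rhoPlus_mem μ ν] with u hu hmem
  rw [phiTilde_eq, h.PsiPlus_phi hmem]
  exact hu

lemma ae_phi_mem (h : DcxPair μ ν) : ∀ᵐ u ∂(rhoPlus μ ν), phi μ ν u ∈ Ioo (0 : ℝ) 1 := by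
  have := ae_rhoMinus_mem μ ν
  rw [← h.map_phi] at this
  exact ae_of_ae_map h.measurable_phi.aemeasurable this

lemma map_phiTilde (h : DcxPair μ ν) : (rhoMinus μ ν).map (phiTilde μ ν) = rhoPlus μ ν := by
  rw [← h.map_phi, Measure.map_map h.measurable_phiTilde h.measurable_phi]
  exact (Measure.map_congr (g := id) h.ae_phiTilde_phi).trans Measure.map_id

lemma ae_phiTilde_mem (h : DcxPair μ ν) :
    ∀ᵐ v ∂(rhoMinus μ ν), phiTilde μ ν v ∈ Ioo 0 (uD μ ν) := by
  have := ae_rhoPlus_mem μ ν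
  rw [← h.map_phiTilde] at this
  exact ae_of_ae_map h.measurable_phiTilde.aemeasurable this

lemma QITS_eq (h : DcxPair μ ν) : QITS μ ν = (rhoPlus μ ν).map fun u => (u, phi μ ν u) := by
  rw [QITS, Measure.restrict_eq_self_of_ae_mem
    (s := {u | 0 < phi μ ν u ∧ phi μ ν u < 1}) h.ae_phi_mem]

lemma QITS_eq_swap (h : DcxPair μ ν) :
    QITS μ ν = (rhoMinus μ ν).map fun v => (phiTilde μ ν v, v) := by
  rw [h.QITS_eq, ← h.map_phi,
    Measure.map_map (g := fun v => (phiTilde μ ν v, v))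
      (h.measurable_phiTilde.prodMk measurable_id) h.measurable_phi]
  refine Measure.map_congr ?_
  filter_upwards [h.ae_phiTilde_phi] with u hu
  simp [hu]

lemma QITS_mem (h : DcxPair μ ν) : QITS μ ν ∈ Qd μ ν := by
  have := h.isProbabilityMeasure_rhoPlus
  have hm : Measurable fun u => (u, phi μ ν u) := measurable_id.prodMk h.measurable_phi
  have hp : IsProbabilityMeasure (QITS μ ν) := by
    rw [h.QITS_eq]
    exact Measure.isProbabilityMeasure_map hm.aemeasurable
  refine ⟨hp, ?_, ?_, ?_⟩
  · rw [h.QITS_eq, Measure.map_map measurable_fst hm]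
    exact Measure.map_id
  · rw [h.QITS_eq, Measure.map_map measurable_snd hm]
    exact h.map_phi
  · have hs : MeasurableSet {p : ℝ × ℝ | p.1 ∈ Ioo 0 (uD μ ν) ∧ p.2 ∈ Ioo (0 : ℝ) 1 ∧ p.1 < p.2} :=
      (measurable_fst measurableSet_Ioo).inter ((measurable_snd measurableSet_Ioo).inter
        (measurableSet_lt measurable_fst measurable_snd))
    rw [← prob_compl_eq_zero_iff hs]
    change ∀ᵐ p ∂(QITS μ ν), p.1 ∈ Ioo 0 (uD μ ν) ∧ p.2 ∈ Ioo (0 : ℝ) 1 ∧ p.1 < p.2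
    rw [h.QITS_eq, ae_map_iff hm.aemeasurable hs]
    filter_upwards [ae_rhoPlus_mem μ ν, h.ae_phi_mem, ae_rhoPlus_lt μ ν] with u h1 h2 h3
    exact ⟨h1, h2, h.lt_phi h1 h3⟩

end DcxPair

/-! ### The mixtures -/

section Mixture

variable {μ ν : Measure ℝ} {u : ℝ} {κ : Measure ℝ}

/-- Almost every point `v` of `κ` has `F_μ⁻¹(u)` strictly between `F_ν⁻¹(u)` and `F_ν⁻¹(v)`. -/
def Straddles (μ ν : Measure ℝ) (u : ℝ) (κ : Measure ℝ) : Prop :=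
  ∀ᵐ v ∂κ, (quantile ν u < quantile μ u ∧ quantile μ u < quantile ν v) ∨
    (quantile μ u < quantile ν u ∧ quantile ν v < quantile μ u)

/-- The weight of `F_ν⁻¹(v)` in the mixture. -/
noncomputable def weight (μ ν : Measure ℝ) (u v : ℝ) : ℝ :=
  (quantile μ u - quantile ν u) / (quantile ν v - quantile ν u)

lemma measurable_weight (μ ν : Measure ℝ) : Measurable fun p : ℝ × ℝ => weight μ ν p.1 p.2 :=
  (((measurable_quantile μ).comp measurable_fst).sub
    ((measurable_quantile ν).comp measurable_fst)).div
    (((measurable_quantile ν).comp measurable_snd).sub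
    ((measurable_quantile ν).comp measurable_fst))

lemma measurable_coweight (μ ν : Measure ℝ) : Measurable fun p : ℝ × ℝ =>
    (quantile ν p.2 - quantile μ p.1) / (quantile ν p.2 - quantile ν p.1) :=
  (((measurable_quantile ν).comp measurable_snd).sub
    ((measurable_quantile μ).comp measurable_fst)).div
    (((measurable_quantile ν).comp measurable_snd).sub
    ((measurable_quantile ν).comp measurable_fst))

lemma measurable_weight_right (μ ν : Measure ℝ) (u : ℝ) : Measurable (weight μ ν u) :=
  (measurable_weight μ ν).comp measurable_prodMk_left

lemma Straddles.weight_mem (h : Straddles μ ν u κ) :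
    ∀ᵐ v ∂κ, weight μ ν u v ∈ Icc (0 : ℝ) 1 ∧ quantile ν v - quantile ν u ≠ 0 := by
  filter_upwards [h] with v hv
  rcases hv with ⟨h1, h2⟩ | ⟨h1, h2⟩
  · have hpos : 0 < quantile ν v - quantile ν u := by linarith
    exact ⟨⟨div_nonneg (by linarith) hpos.le, (div_le_one hpos).2 (by linarith)⟩, hpos.ne'⟩
  · have hneg : quantile ν v - quantile ν u < 0 := by linarith
    exact ⟨⟨div_nonneg_of_nonpos (by linarith) hneg.le, (div_le_one_of_neg hneg).2 (by linarith)⟩,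
      hneg.ne⟩

lemma Straddles.coweight_eq (h : Straddles μ ν u κ) :
    ∀ᵐ v ∂κ, ENNReal.ofReal ((quantile ν v - quantile μ u) / (quantile ν v - quantile ν u))
      = ENNReal.ofReal (1 - weight μ ν u v) := by
  filter_upwards [h.weight_mem] with v hv
  congr 1
  rw [weight, eq_sub_iff_add_eq, ← add_div, div_eq_one_iff_eq hv.2]
  ring

lemma Straddles.lintegral_coweight_add (h : Straddles μ ν u κ) [IsProbabilityMeasure κ] :
    ∫⁻ v, ENNReal.ofReal ((quantile ν v - quantile μ u) / (quantile ν v - quantile ν u)) ∂κ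
      + ∫⁻ v, ENNReal.ofReal (weight μ ν u v) ∂κ = 1 := by
  rw [lintegral_congr_ae h.coweight_eq,
    ← lintegral_add_right _ (measurable_weight_right μ ν u).ennreal_ofReal]
  refine (lintegral_congr_ae (g := fun _ => 1) ?_).trans (by simp)
  filter_upwards [h.weight_mem] with v hv
  rw [← ENNReal.ofReal_add (sub_nonneg.2 hv.1.2) hv.1.1]
  simp

lemma mixture_apply {B : Set ℝ} (hB : MeasurableSet B) :
    mixture μ ν u κ B
      = ∫⁻ v, ENNReal.ofReal (weight μ ν u v) * B.indicator 1 (quantile ν v) ∂κ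
        + (∫⁻ v, ENNReal.ofReal
            ((quantile ν v - quantile μ u) / (quantile ν v - quantile ν u)) ∂κ)
          * B.indicator 1 (quantile ν u) := by
  rw [mixture, Measure.add_apply, Measure.map_apply (measurable_quantile ν) hB,
    Measure.smul_apply, Measure.dirac_apply' _ hB, smul_eq_mul,
    withDensity_apply _ (measurable_quantile ν hB),
    ← lintegral_indicator (measurable_quantile ν hB)]
  congr 1
  refine lintegral_congr fun v => ?_
  by_cases hv : quantile ν v ∈ B
  · rw [indicator_of_mem (show v ∈ quantile ν ⁻¹' B from hv), indicator_of_mem hv]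
    simp [weight]
  · rw [indicator_of_notMem (show v ∉ quantile ν ⁻¹' B from hv), indicator_of_notMem hv]
    simp

/-- Subtraction-free form of: mixture = δ_{b(u)} + ∫ weight(v) (δ_{b(v)} - δ_{b(u)}) κ(dv). The mass
leaving b(u) is put on the left because the values lie in `ENNReal`. -/
lemma Straddles.mixture_apply_add (h : Straddles μ ν u κ) [IsProbabilityMeasure κ] {B : Set ℝ}
    (hB : MeasurableSet B) :
    mixture μ ν u κ B + ∫⁻ v, ENNReal.ofReal (weight μ ν u v) * B.indicator 1 (quantile ν u) ∂κ
      = B.indicator 1 (quantile ν u)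
        + ∫⁻ v, ENNReal.ofReal (weight μ ν u v) * B.indicator 1 (quantile ν v) ∂κ := by
  rw [mixture_apply hB, lintegral_mul_const _ (measurable_weight_right μ ν u).ennreal_ofReal,
    add_assoc, ← add_mul, h.lintegral_coweight_add, one_mul, add_comm]

lemma Straddles.isProbabilityMeasure_mixture (h : Straddles μ ν u κ) [IsProbabilityMeasure κ] :
    IsProbabilityMeasure (mixture μ ν u κ) := by
  refine ⟨?_⟩
  rw [mixture_apply MeasurableSet.univ]
  simp only [indicator_univ, Pi.one_apply, mul_one]
  rw [add_comm]
  exact h.lintegral_coweight_add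

lemma Straddles.integrable_weight (h : Straddles μ ν u κ) [IsProbabilityMeasure κ] :
    Integrable (weight μ ν u) κ := by
  refine Integrable.of_bound (measurable_weight_right μ ν u).aestronglyMeasurable 1 ?_
  filter_upwards [h.weight_mem] with v hv
  rw [Real.norm_eq_abs, abs_of_nonneg hv.1.1]
  exact hv.1.2

lemma Straddles.toReal_lintegral_coweight (h : Straddles μ ν u κ) [IsProbabilityMeasure κ] :
    (∫⁻ v, ENNReal.ofReal
      ((quantile ν v - quantile μ u) / (quantile ν v - quantile ν u)) ∂κ).toReal
      = 1 - ∫ v, weight μ ν u v ∂κ := by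
  rw [lintegral_congr_ae h.coweight_eq, ← integral_eq_lintegral_of_nonneg_ae,
    integral_sub (integrable_const 1) h.integrable_weight]
  · simp
  · filter_upwards [h.weight_mem] with v hv using sub_nonneg.2 hv.1.2
  · exact ((measurable_weight_right μ ν u).const_sub 1).aestronglyMeasurable

lemma Straddles.weight_smul (h : Straddles μ ν u κ) :
    (fun v => (ENNReal.ofReal (weight μ ν u v)).toReal • quantile ν v) =ᵐ[κ]
      fun v => (quantile μ u - quantile ν u) + weight μ ν u v * quantile ν u := by
  filter_upwards [h.weight_mem] with v hv
  rw [ENNReal.toReal_ofReal hv.1.1, smul_eq_mul, ← sub_eq_iff_eq_add, ← mul_sub, weight,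
    div_mul_cancel₀ _ hv.2]

/-- The weight times the displacement b(v) - b(u) is a(u) - b(u) for every v. This gives
integrability without any moment of b under κ, and puts the barycentre at a(u). -/
lemma Straddles.integrable_and_integral (h : Straddles μ ν u κ) [IsProbabilityMeasure κ] :
    Integrable (fun y : ℝ => y) (mixture μ ν u κ) ∧
      ∫ y, y ∂(mixture μ ν u κ) = quantile μ u := by
  have hwm := (measurable_weight_right μ ν u).ennreal_ofReal
  have hfin : ∀ᵐ v ∂κ, ENNReal.ofReal (weight μ ν u v) < ⊤ := ae_of_all _ fun _ => ENNReal.ofReal_lt_top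
  have hi1 : Integrable (fun v => (quantile μ u - quantile ν u) + weight μ ν u v * quantile ν u) κ :=
    (integrable_const _).add (h.integrable_weight.mul_const _)
  have hi2 : Integrable (quantile ν) (κ.withDensity fun v => ENNReal.ofReal (weight μ ν u v)) := by
    rw [integrable_withDensity_iff_integrable_smul' hwm hfin]
    exact hi1.congr h.weight_smul.symm
  have hi3 : Integrable (fun y : ℝ => y)
      ((κ.withDensity fun v => ENNReal.ofReal (weight μ ν u v)).map (quantile ν)) :=
    (integrable_map_measure aestronglyMeasurable_id (measurable_quantile ν).aemeasurable).2 hi2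
  have hle : ∫⁻ v, ENNReal.ofReal
      ((quantile ν v - quantile μ u) / (quantile ν v - quantile ν u)) ∂κ ≠ ⊤ :=
    ne_top_of_le_ne_top ENNReal.one_ne_top (le_self_add.trans h.lintegral_coweight_add.le)
  have hi4 : Integrable (fun y : ℝ => y) ((∫⁻ v, ENNReal.ofReal
      ((quantile ν v - quantile μ u) / (quantile ν v - quantile ν u)) ∂κ)
        • Measure.dirac (quantile ν u)) :=
    (integrable_dirac (by simp)).smul_measure hle
  refine ⟨hi3.add_measure hi4, ?_⟩
  refine (integral_add_measure hi3 hi4).trans ?_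
  rw [integral_map (f := fun y : ℝ => y) (measurable_quantile ν).aemeasurable
      aestronglyMeasurable_id,
    integral_withDensity_eq_integral_toReal_smul hwm hfin, integral_congr_ae h.weight_smul,
    integral_smul_measure, integral_dirac, h.toReal_lintegral_coweight,
    integral_add (integrable_const _) (h.integrable_weight.mul_const _), integral_mul_const]
  simp
  ring

lemma measurable_mixture (μ ν : Measure ℝ) (π : Kernel ℝ ℝ) [IsFiniteKernel π] :
    Measurable fun u => mixture μ ν u (π u) := by
  refine Measure.measurable_of_measurable_coe _ fun B hB => ?_
  simp_rw [mixture_apply hB]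
  have hind : Measurable (B.indicator (1 : ℝ → ENNReal)) := measurable_one.indicator hB
  have h1 : Measurable fun p : ℝ × ℝ =>
      ENNReal.ofReal (weight μ ν p.1 p.2) * B.indicator 1 (quantile ν p.2) :=
    (measurable_weight μ ν).ennreal_ofReal.mul
      (hind.comp ((measurable_quantile ν).comp measurable_snd))
  exact h1.lintegral_kernel_prod_right.add
    ((measurable_coweight μ ν).ennreal_ofReal.lintegral_kernel_prod_right.mul
      (hind.comp (measurable_quantile ν)))

end Mixture

/-! ### m̃ as a Markov kernel -/

section MTilde

variable {μ ν : Measure ℝ} {πp πm : Kernel ℝ ℝ} {u : ℝ}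

lemma measurableSet_quantile_lt_right (μ ν : Measure ℝ) :
    MeasurableSet {p : ℝ × ℝ | p.2 ∈ Ioo (0 : ℝ) 1 ∧ quantile μ p.1 < quantile ν p.2} :=
  (measurable_snd measurableSet_Ioo).inter (measurableSet_lt
    ((measurable_quantile μ).comp measurable_fst) ((measurable_quantile ν).comp measurable_snd))

lemma measurableSet_quantile_lt_left (μ ν : Measure ℝ) :
    MeasurableSet {p : ℝ × ℝ | p.2 ∈ Ioo (0 : ℝ) 1 ∧ quantile ν p.2 < quantile μ p.1} :=
  (measurable_snd measurableSet_Ioo).inter (measurableSet_lt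
    ((measurable_quantile ν).comp measurable_snd) ((measurable_quantile μ).comp measurable_fst))

lemma isProbabilityMeasure_and_ae {κ : Measure ℝ} (hκ : κ univ ≤ 1) {s : Set ℝ}
    (hs : MeasurableSet s) (h : κ s = 1) : IsProbabilityMeasure κ ∧ ∀ᵐ v ∂κ, v ∈ s := by
  have hp : IsProbabilityMeasure κ := ⟨le_antisymm hκ (h ▸ measure_mono (subset_univ s))⟩
  exact ⟨hp, (prob_compl_eq_zero_iff hs).2 h⟩

lemma straddles_plus (hp : ∀ u, πp u univ ≤ 1) (h1 : quantile ν u < quantile μ u)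
    (h2 : πp u {v | v ∈ Ioo (0 : ℝ) 1 ∧ quantile μ u < quantile ν v} = 1) :
    IsProbabilityMeasure (πp u) ∧ Straddles μ ν u (πp u) := by
  obtain ⟨h3, h4⟩ := isProbabilityMeasure_and_ae (hp u)
    (measurable_prodMk_left (x := u) (measurableSet_quantile_lt_right μ ν)) h2
  refine ⟨h3, ?_⟩
  filter_upwards [h4] with v hv using Or.inl ⟨h1, hv.2⟩

lemma straddles_minus (hm : ∀ u, πm u univ ≤ 1) (h1 : quantile μ u < quantile ν u)
    (h2 : πm u {v | v ∈ Ioo (0 : ℝ) 1 ∧ quantile ν v < quantile μ u} = 1) :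
    IsProbabilityMeasure (πm u) ∧ Straddles μ ν u (πm u) := by
  obtain ⟨h3, h4⟩ := isProbabilityMeasure_and_ae (hm u)
    (measurable_prodMk_left (x := u) (measurableSet_quantile_lt_left μ ν)) h2
  refine ⟨h3, ?_⟩
  filter_upwards [h4] with v hv using Or.inr ⟨h1, hv.2⟩

lemma measurable_mTilde (hp : ∀ u, πp u univ ≤ 1) (hm : ∀ u, πm u univ ≤ 1) :
    Measurable (mTilde μ ν πp πm) := by
  classical
  have : IsFiniteKernel πp := ⟨⟨1, ENNReal.one_lt_top, hp⟩⟩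
  have : IsFiniteKernel πm := ⟨⟨1, ENNReal.one_lt_top, hm⟩⟩
  have hS1 : MeasurableSet {u : ℝ | quantile ν u < quantile μ u ∧ u ∈ Ioo 0 (uD μ ν) ∧
      πp u {v | v ∈ Ioo (0 : ℝ) 1 ∧ quantile μ u < quantile ν v} = 1} :=
    (measurableSet_lt (measurable_quantile ν) (measurable_quantile μ)).inter
      (measurableSet_Ioo.inter ((Kernel.measurable_kernel_prodMk_left (κ := πp)
        (measurableSet_quantile_lt_right μ ν)) (measurableSet_singleton 1)))
  have hS2 : MeasurableSet {u : ℝ | quantile μ u < quantile ν u ∧ u ∈ Ioo (0 : ℝ) 1 ∧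
      πm u {v | v ∈ Ioo (0 : ℝ) 1 ∧ quantile ν v < quantile μ u} = 1} :=
    (measurableSet_lt (measurable_quantile μ) (measurable_quantile ν)).inter
      (measurableSet_Ioo.inter ((Kernel.measurable_kernel_prodMk_left (κ := πm)
        (measurableSet_quantile_lt_left μ ν)) (measurableSet_singleton 1)))
  exact Measurable.ite hS1 (measurable_mixture μ ν πp) (Measurable.ite hS2
    (measurable_mixture μ ν πm) (Measure.measurable_dirac.comp (measurable_quantile ν)))

lemma isProbabilityMeasure_mTilde (hp : ∀ u, πp u univ ≤ 1) (hm : ∀ u, πm u univ ≤ 1) (u : ℝ) :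
    IsProbabilityMeasure (mTilde μ ν πp πm u) := by
  unfold mTilde
  split_ifs with h1 h2
  · obtain ⟨h3, h4⟩ := straddles_plus hp h1.1 h1.2.2
    exact h4.isProbabilityMeasure_mixture
  · obtain ⟨h3, h4⟩ := straddles_minus hm h2.1 h2.2.2
    exact h4.isProbabilityMeasure_mixture
  · infer_instance

end MTilde

/-- A kernel of mass at most 1 whose integral against a probability measure is 1 has mass 1 almost
everywhere, so sub-Markov disintegration kernels lose no mass where it matters. -/
lemma ae_apply_eq_one {ρ : Measure ℝ} [IsProbabilityMeasure ρ] {π : Kernel ℝ ℝ}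
    (hπ : ∀ u, π u univ ≤ 1) (hP : (ρ ⊗ₘ π) univ = 1) {p : ℝ × ℝ → Prop}
    (h : ∀ᵐ x ∂(ρ ⊗ₘ π), p x) : ∀ᵐ u ∂ρ, π u {v | p (u, v)} = 1 := by
  have : IsFiniteKernel π := ⟨⟨1, ENNReal.one_lt_top, hπ⟩⟩
  have hmass : (fun u => π u univ) =ᵐ[ρ] fun _ => 1 := by
    have e : ∫⁻ u, π u univ ∂ρ = 1 := by
      rw [← hP, Measure.compProd_apply MeasurableSet.univ]
      rfl
    refine ae_eq_of_ae_le_of_lintegral_le (ae_of_all _ hπ) (by simp [e]) aemeasurable_const ?_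
    simp [e]
  filter_upwards [hmass, Measure.ae_ae_of_ae_compProd h] with u h1 h2
  rw [← h1]
  refine measure_congr ?_
  filter_upwards [h2] with v hv
  exact propext ⟨fun _ => trivial, fun _ => hv⟩

/-! ### Almost sure position of the paired points, and factorisation of the weights -/

section Disintegration

variable {μ ν : Measure ℝ} {Q : Measure (ℝ × ℝ)} {πp πm : Kernel ℝ ℝ} {u : ℝ}

lemma IsDisintegration.isFiniteKernel_plus (hd : IsDisintegration μ ν Q πp πm) :
    IsFiniteKernel πp := ⟨⟨1, ENNReal.one_lt_top, hd.plus_le⟩⟩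

lemma IsDisintegration.isFiniteKernel_minus (hd : IsDisintegration μ ν Q πp πm) :
    IsFiniteKernel πm := ⟨⟨1, ENNReal.one_lt_top, hd.minus_le⟩⟩

/-- The marginals give b(u) < a(u) and a(v) < b(v), and u < v gives a(u) ≤ a(v) between them. This
is the only use made of the constraint u < v. -/
lemma IsQd.ae_lt (h : DcxPair μ ν) (hQ : IsQd μ ν Q) :
    ∀ᵐ p ∂Q, (p.1 ∈ Ioo 0 (uD μ ν) ∧ p.2 ∈ Ioo (0 : ℝ) 1) ∧ quantile μ p.1 < quantile ν p.2 ∧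
      quantile ν p.1 < quantile μ p.2 := by
  have := hQ.prob
  have hs : MeasurableSet {p : ℝ × ℝ | p.1 ∈ Ioo 0 (uD μ ν) ∧ p.2 ∈ Ioo (0 : ℝ) 1 ∧ p.1 < p.2} :=
    (measurable_fst measurableSet_Ioo).inter ((measurable_snd measurableSet_Ioo).inter
      (measurableSet_lt measurable_fst measurable_snd))
  have h1 : ∀ᵐ p ∂Q, p.1 ∈ Ioo 0 (uD μ ν) ∧ p.2 ∈ Ioo (0 : ℝ) 1 ∧ p.1 < p.2 :=
    (prob_compl_eq_zero_iff hs).2 hQ.lt_ae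
  have h2 : ∀ᵐ p ∂Q, quantile ν p.1 < quantile μ p.1 :=
    ae_of_ae_map measurable_fst.aemeasurable (hQ.fst_eq ▸ ae_rhoPlus_lt μ ν)
  have h3 : ∀ᵐ p ∂Q, quantile μ p.2 < quantile ν p.2 :=
    ae_of_ae_map measurable_snd.aemeasurable (hQ.snd_eq ▸ ae_rhoMinus_lt μ ν)
  filter_upwards [h1, h2, h3] with p h1 h2 h3
  have hmono : quantile μ p.1 ≤ quantile μ p.2 :=
    monotoneOn_quantile (h.mem_of_mem h1.1) h1.2.1 h1.2.2.le
  exact ⟨⟨h1.1, h1.2.1⟩, hmono.trans_lt h3, h2.trans_le hmono⟩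

/-- Off a null set the mass condition in the first branch of m̃ is automatic; it passes from the
first marginal to Lebesgue measure because the density is positive where a > b. -/
lemma ae_plus_eq_one (h : DcxPair μ ν) (hQ : IsQd μ ν Q) (hd : IsDisintegration μ ν Q πp πm) :
    ∀ᵐ u, u ∈ Ioo 0 (uD μ ν) → quantile ν u < quantile μ u →
      πp u {v | v ∈ Ioo (0 : ℝ) 1 ∧ quantile μ u < quantile ν v} = 1 := by
  have := hQ.prob
  have := h.isProbabilityMeasure_rhoPlus
  have hae := hQ.ae_lt h
  have hu : Q univ = 1 := measure_univ
  rw [hd.eq_plus] at hae hu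
  have key := ae_apply_eq_one (p := fun p : ℝ × ℝ => p.2 ∈ Ioo (0 : ℝ) 1 ∧
    quantile μ p.1 < quantile ν p.2) hd.plus_le hu (hae.mono fun p hp => ⟨hp.1.2, hp.2.1⟩)
  rw [rhoPlus, ae_withDensity_iff ((measurable_gapPos μ ν).const_mul _).ennreal_ofReal,
    ae_restrict_iff' measurableSet_Ioo] at key
  filter_upwards [key] with u hu hmem hlt
  refine hu hmem ?_
  have h1 : 0 < gapPos μ ν u := lt_max_of_lt_left (sub_pos.2 hlt)
  have h2 := h.gammaD_pos
  exact (ENNReal.ofReal_pos.2 (by positivity)).ne'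

lemma ae_minus_eq_one (h : DcxPair μ ν) (hQ : IsQd μ ν Q) (hd : IsDisintegration μ ν Q πp πm) :
    ∀ᵐ u, u ∈ Ioo (0 : ℝ) 1 → quantile μ u < quantile ν u →
      πm u {v | v ∈ Ioo (0 : ℝ) 1 ∧ quantile ν v < quantile μ u} = 1 := by
  have := hQ.prob
  have := h.isProbabilityMeasure_rhoMinus
  have hsw : Q.map Prod.swap = rhoMinus μ ν ⊗ₘ πm := by
    rw [hd.eq_minus, Measure.map_map measurable_swap measurable_swap, Prod.swap_swap_eq,
      Measure.map_id]
  have hae : ∀ᵐ p ∂(rhoMinus μ ν ⊗ₘ πm), p.2 ∈ Ioo (0 : ℝ) 1 ∧ quantile ν p.2 < quantile μ p.1 := by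
    rw [← hsw, ae_map_iff measurable_swap.aemeasurable (measurableSet_quantile_lt_left μ ν)]
    filter_upwards [hQ.ae_lt h] with p hp using ⟨h.mem_of_mem hp.1.1, hp.2.2⟩
  have hu : (Q.map Prod.swap) univ = 1 := by
    have := Measure.isProbabilityMeasure_map (μ := Q) measurable_swap.aemeasurable
    exact measure_univ
  rw [hsw] at hu
  have key := ae_apply_eq_one hd.minus_le hu hae
  rw [rhoMinus, gapNeg_eq, ae_withDensity_iff
    ((measurable_gapPos ν μ).const_mul _).ennreal_ofReal, ae_restrict_iff' measurableSet_Ioo] at key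
  filter_upwards [key] with u hu hmem hlt
  refine hu hmem ?_
  have h1 : 0 < gapPos ν μ u := lt_max_of_lt_left (sub_pos.2 hlt)
  have h2 := h.gammaD_pos
  exact (ENNReal.ofReal_pos.2 (by positivity)).ne'

/-- Paired with `lintegral_minus`: both disintegrations compute the same Q-integral, so an integral
over the points u can be traded for one over the points v. -/
lemma lintegral_plus (h : DcxPair μ ν) (hd : IsDisintegration μ ν Q πp πm) {F : ℝ × ℝ → ENNReal}
    (hF : Measurable F) :
    ∫⁻ u in Ioo (0 : ℝ) 1, (Ioo 0 (uD μ ν)).indicator (fun u =>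
      ENNReal.ofReal (1 / gammaD μ ν * gapPos μ ν u) * ∫⁻ v, F (u, v) ∂(πp u)) u
      = ∫⁻ p, F p ∂Q := by
  have := hd.isFiniteKernel_plus
  have := h.isProbabilityMeasure_rhoPlus
  rw [hd.eq_plus, Measure.lintegral_compProd hF, rhoPlus, lintegral_indicator measurableSet_Ioo,
    Measure.restrict_restrict measurableSet_Ioo, inter_eq_self_of_subset_left
      (fun u hu => h.mem_of_mem hu : Ioo 0 (uD μ ν) ⊆ Ioo (0 : ℝ) 1),
    lintegral_withDensity_eq_lintegral_mul _
      ((measurable_gapPos μ ν).const_mul _).ennreal_ofReal hF.lintegral_kernel_prod_right']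
  rfl

lemma lintegral_minus (h : DcxPair μ ν) (hd : IsDisintegration μ ν Q πp πm) {F : ℝ × ℝ → ENNReal}
    (hF : Measurable F) :
    ∫⁻ v in Ioo (0 : ℝ) 1,
      ENNReal.ofReal (1 / gammaD μ ν * gapPos ν μ v) * ∫⁻ u, F (u, v) ∂(πm v)
      = ∫⁻ p, F p ∂Q := by
  have := hd.isFiniteKernel_minus
  have := h.isProbabilityMeasure_rhoMinus
  have hF' : Measurable fun p : ℝ × ℝ => F p.swap := hF.comp measurable_swap
  rw [hd.eq_minus, lintegral_map hF measurable_swap, Measure.lintegral_compProd hF', rhoMinus,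
    gapNeg_eq, lintegral_withDensity_eq_lintegral_mul _
      ((measurable_gapPos ν μ).const_mul _).ennreal_ofReal hF'.lintegral_kernel_prod_right']
  rfl

/-- Splits the weight into the marginal density at u and a factor γ divided by the distance between
the two ν-quantiles. The latter factor is common to both sides of a pair. -/
lemma ofReal_weight_of_le {γ v : ℝ} (hγ : 0 < γ) (hu : quantile ν u ≤ quantile μ u) :
    ENNReal.ofReal (weight μ ν u v) = ENNReal.ofReal (1 / γ * gapPos μ ν u) *
      ENNReal.ofReal (γ / (quantile ν v - quantile ν u)) := by
  have h1 := gapPos_nonneg μ ν u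
  rw [← ENNReal.ofReal_mul (mul_nonneg (by positivity) h1), gapPos, max_eq_left (sub_nonneg.2 hu),
    weight]
  congr 1
  field_simp

lemma ofReal_weight_of_ge {γ v : ℝ} (hγ : 0 < γ) (hu : quantile μ u ≤ quantile ν u) :
    ENNReal.ofReal (weight μ ν u v) = ENNReal.ofReal (1 / γ * gapPos ν μ u) *
      ENNReal.ofReal (γ / (quantile ν u - quantile ν v)) := by
  have h1 := gapPos_nonneg ν μ u
  rw [← ENNReal.ofReal_mul (mul_nonneg (by positivity) h1), gapPos, max_eq_left (sub_nonneg.2 hu),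
    weight, ← neg_div_neg_eq, neg_sub, neg_sub]
  congr 1
  field_simp

end Disintegration

/-! ### Second marginal and barycentres of m̃ -/

section Marginal

variable {μ ν : Measure ℝ} {Q : Measure (ℝ × ℝ)} {πp πm : Kernel ℝ ℝ} {u : ℝ} {B : Set ℝ}

lemma Straddles.lintegral_weight_mul_le {κ : Measure ℝ} (h : Straddles μ ν u κ)
    [IsProbabilityMeasure κ] (f : ℝ → ENNReal) (hf : ∀ v, f v ≤ 1) :
    ∫⁻ v, ENNReal.ofReal (weight μ ν u v) * f v ∂κ ≤ 1 := by
  refine (lintegral_mono fun v => mul_le_of_le_one_right' (hf v)).trans ?_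
  exact le_add_self.trans h.lintegral_coweight_add.le

/-- Pointwise balance of the exchange. P and P' are the masses that leave b(u) and arrive in B when
a > b; N and N' play these roles when a < b. F₁ tests B at the lower point b(p.1) of a pair and F₂
at the upper point b(p.2), so they swap between the two cases. The bounds on P and N permit the
later cancellation. -/
lemma mTilde_apply_add (h : DcxPair μ ν) (hd : IsDisintegration μ ν Q πp πm)
    (hB : MeasurableSet B) (hu : u ∈ Ioo (0 : ℝ) 1)
    (hplus : u ∈ Ioo 0 (uD μ ν) → quantile ν u < quantile μ u →
      πp u {v | v ∈ Ioo (0 : ℝ) 1 ∧ quantile μ u < quantile ν v} = 1)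
    (hminus : u ∈ Ioo (0 : ℝ) 1 → quantile μ u < quantile ν u →
      πm u {v | v ∈ Ioo (0 : ℝ) 1 ∧ quantile ν v < quantile μ u} = 1)
    {F₁ F₂ : ℝ × ℝ → ENNReal}
    (hF₁ : F₁ = fun p => ENNReal.ofReal (gammaD μ ν / (quantile ν p.2 - quantile ν p.1))
      * B.indicator 1 (quantile ν p.1))
    (hF₂ : F₂ = fun p => ENNReal.ofReal (gammaD μ ν / (quantile ν p.2 - quantile ν p.1))
      * B.indicator 1 (quantile ν p.2))
    {P P' N N' : ENNReal}
    (hP : P = (Ioo 0 (uD μ ν)).indicator (fun u =>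
      ENNReal.ofReal (1 / gammaD μ ν * gapPos μ ν u) * ∫⁻ v, F₁ (u, v) ∂(πp u)) u)
    (hP' : P' = (Ioo 0 (uD μ ν)).indicator (fun u =>
      ENNReal.ofReal (1 / gammaD μ ν * gapPos μ ν u) * ∫⁻ v, F₂ (u, v) ∂(πp u)) u)
    (hN : N = ENNReal.ofReal (1 / gammaD μ ν * gapPos ν μ u) * ∫⁻ v, F₂ (v, u) ∂(πm u))
    (hN' : N' = ENNReal.ofReal (1 / gammaD μ ν * gapPos ν μ u) * ∫⁻ v, F₁ (v, u) ∂(πm u)) :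
    mTilde μ ν πp πm u B + (P + N) = B.indicator 1 (quantile ν u) + (P' + N') ∧
      P ≤ 1 ∧ N ≤ 1 := by
  have hγ := h.gammaD_pos
  have hone : ∀ y, B.indicator (1 : ℝ → ENNReal) y ≤ 1 := fun y =>
    indicator_le_self' (fun _ _ => zero_le) y
  by_cases h1 : quantile ν u < quantile μ u ∧ u ∈ Ioo 0 (uD μ ν)
  · have hg : gapPos ν μ u = 0 := max_eq_right (sub_nonpos.2 h1.1.le)
    have hone' := hplus h1.2 h1.1
    obtain ⟨hp, hs⟩ := straddles_plus hd.plus_le h1.1 hone'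
    have hm : mTilde μ ν πp πm u = mixture μ ν u (πp u) := if_pos ⟨h1.1, h1.2, hone'⟩
    have key : ∀ f : ℝ → ENNReal, ENNReal.ofReal (1 / gammaD μ ν * gapPos μ ν u) *
        ∫⁻ v, ENNReal.ofReal (gammaD μ ν / (quantile ν v - quantile ν u)) * f v ∂(πp u)
        = ∫⁻ v, ENNReal.ofReal (weight μ ν u v) * f v ∂(πp u) := by
      intro f
      rw [← lintegral_const_mul' _ _ ENNReal.ofReal_ne_top]
      simp_rw [ofReal_weight_of_le hγ h1.1.le, mul_assoc]
    have hN0 : N = 0 := by simp [hN, hg]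
    have hN0' : N' = 0 := by simp [hN', hg]
    rw [indicator_of_mem h1.2, hF₁] at hP
    rw [indicator_of_mem h1.2, hF₂] at hP'
    rw [key fun _ => B.indicator 1 (quantile ν u)] at hP
    rw [key fun v => B.indicator 1 (quantile ν v)] at hP'
    rw [hN0, hN0', hP, hP', add_zero, add_zero, hm]
    exact ⟨hs.mixture_apply_add hB, hs.lintegral_weight_mul_le _ fun _ => hone _, zero_le⟩
  · have hP0 : P = 0 ∧ P' = 0 := by
      rw [hP, hP']
      by_cases hmem : u ∈ Ioo 0 (uD μ ν)
      · have hg : gapPos μ ν u = 0 :=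
          max_eq_right (sub_nonpos.2 (not_lt.1 fun hlt => h1 ⟨hlt, hmem⟩))
        simp [hg]
      · simp [indicator_of_notMem hmem]
    rw [hP0.1, hP0.2, zero_add, zero_add]
    have hm1 : mTilde μ ν πp πm u = if quantile μ u < quantile ν u ∧ u ∈ Ioo (0 : ℝ) 1 ∧
        πm u {v | v ∈ Ioo (0 : ℝ) 1 ∧ quantile ν v < quantile μ u} = 1 then
        mixture μ ν u (πm u) else Measure.dirac (quantile ν u) :=
      if_neg fun hc => h1 ⟨hc.1, hc.2.1⟩
    rw [hm1]
    by_cases h2 : quantile μ u < quantile ν u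
    · have hone' := hminus hu h2
      obtain ⟨hp, hs⟩ := straddles_minus hd.minus_le h2 hone'
      have key : ∀ f : ℝ → ENNReal, ENNReal.ofReal (1 / gammaD μ ν * gapPos ν μ u) *
          ∫⁻ v, ENNReal.ofReal (gammaD μ ν / (quantile ν u - quantile ν v)) * f v ∂(πm u)
          = ∫⁻ v, ENNReal.ofReal (weight μ ν u v) * f v ∂(πm u) := by
        intro f
        rw [← lintegral_const_mul' _ _ ENNReal.ofReal_ne_top]
        simp_rw [ofReal_weight_of_ge hγ h2.le, mul_assoc]
      rw [hF₂] at hN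
      rw [hF₁] at hN'
      rw [key fun _ => B.indicator 1 (quantile ν u)] at hN
      rw [key fun v => B.indicator 1 (quantile ν v)] at hN'
      rw [if_pos ⟨h2, hu, hone'⟩, hN, hN']
      exact ⟨hs.mixture_apply_add hB, zero_le, hs.lintegral_weight_mul_le _ fun _ => hone _⟩
    · have hg : gapPos ν μ u = 0 := max_eq_right (sub_nonpos.2 (not_lt.1 h2))
      rw [if_neg fun hc => h2 hc.1, hN, hN', hg, Measure.dirac_apply' _ hB]
      simp

/-- Integrate the balance over (0,1). Departures from lower points equal arrivals there (∫ P = ∫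
N'), and similarly at upper points (∫ P' = ∫ N); these are finite and cancel, leaving the law of b.
-/
lemma lintegral_mTilde (h : DcxPair μ ν) (hQ : IsQd μ ν Q) (hd : IsDisintegration μ ν Q πp πm)
    (hB : MeasurableSet B) : ∫⁻ u in Ioo (0 : ℝ) 1, mTilde μ ν πp πm u B = ν B := by
  have := h.prob_right
  have := hd.isFiniteKernel_plus
  have := hd.isFiniteKernel_minus
  set F₁ : ℝ × ℝ → ENNReal := fun p =>
    ENNReal.ofReal (gammaD μ ν / (quantile ν p.2 - quantile ν p.1))
      * B.indicator 1 (quantile ν p.1) with hF₁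
  set F₂ : ℝ × ℝ → ENNReal := fun p =>
    ENNReal.ofReal (gammaD μ ν / (quantile ν p.2 - quantile ν p.1))
      * B.indicator 1 (quantile ν p.2) with hF₂
  have hind : Measurable (B.indicator (1 : ℝ → ENNReal)) := measurable_one.indicator hB
  have hb1 : Measurable fun p : ℝ × ℝ => quantile ν p.1 := (measurable_quantile ν).comp measurable_fst
  have hb2 : Measurable fun p : ℝ × ℝ => quantile ν p.2 := (measurable_quantile ν).comp measurable_snd
  have hk : Measurable fun p : ℝ × ℝ =>
      ENNReal.ofReal (gammaD μ ν / (quantile ν p.2 - quantile ν p.1)) :=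
    (measurable_const.div (hb2.sub hb1)).ennreal_ofReal
  have hF₁m : Measurable F₁ := hk.mul (hind.comp hb1)
  have hF₂m : Measurable F₂ := hk.mul (hind.comp hb2)
  have hcp : Measurable fun u => ENNReal.ofReal (1 / gammaD μ ν * gapPos μ ν u) :=
    ((measurable_gapPos μ ν).const_mul _).ennreal_ofReal
  have hcm : Measurable fun u => ENNReal.ofReal (1 / gammaD μ ν * gapPos ν μ u) :=
    ((measurable_gapPos ν μ).const_mul _).ennreal_ofReal
  set P := (Ioo 0 (uD μ ν)).indicator (fun u =>
      ENNReal.ofReal (1 / gammaD μ ν * gapPos μ ν u) * ∫⁻ v, F₁ (u, v) ∂(πp u)) with hP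
  set P' := (Ioo 0 (uD μ ν)).indicator (fun u =>
      ENNReal.ofReal (1 / gammaD μ ν * gapPos μ ν u) * ∫⁻ v, F₂ (u, v) ∂(πp u)) with hP'
  set N := fun u =>
    ENNReal.ofReal (1 / gammaD μ ν * gapPos ν μ u) * ∫⁻ v, F₂ (v, u) ∂(πm u) with hN
  set N' := fun u =>
    ENNReal.ofReal (1 / gammaD μ ν * gapPos ν μ u) * ∫⁻ v, F₁ (v, u) ∂(πm u) with hN'
  have hPm : Measurable P :=
    (hcp.mul hF₁m.lintegral_kernel_prod_right').indicator measurableSet_Ioo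
  have hPm' : Measurable P' :=
    (hcp.mul hF₂m.lintegral_kernel_prod_right').indicator measurableSet_Ioo
  have hNm : Measurable N :=
    hcm.mul (hF₂m.comp measurable_swap).lintegral_kernel_prod_right'
  have hNm' : Measurable N' :=
    hcm.mul (hF₁m.comp measurable_swap).lintegral_kernel_prod_right'
  have hae : ∀ᵐ u ∂(volume.restrict (Ioo (0 : ℝ) 1)),
      mTilde μ ν πp πm u B + (P u + N u) = B.indicator 1 (quantile ν u) + (P' u + N' u) ∧
        P u ≤ 1 ∧ N u ≤ 1 := by
    filter_upwards [ae_restrict_mem measurableSet_Ioo, ae_restrict_of_ae (ae_plus_eq_one h hQ hd),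
      ae_restrict_of_ae (ae_minus_eq_one h hQ hd)] with u hu h1 h2
    exact mTilde_apply_add h hd hB hu h1 h2 hF₁ hF₂ rfl rfl rfl rfl
  have hle : ∀ f : ℝ → ENNReal, (∀ᵐ u ∂(volume.restrict (Ioo (0 : ℝ) 1)), f u ≤ 1) →
      ∫⁻ u in Ioo (0 : ℝ) 1, f u ≠ ⊤ := fun f hf =>
    ne_top_of_le_ne_top ENNReal.one_ne_top ((lintegral_mono_ae hf).trans (by simp))
  have hPfin := hle P (hae.mono fun u hu => hu.2.1)
  have hNfin := hle N (hae.mono fun u hu => hu.2.2)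
  have key := lintegral_congr_ae (hae.mono fun u hu => hu.1)
  have hPP : ∫⁻ u in Ioo (0 : ℝ) 1, P u = ∫⁻ u in Ioo (0 : ℝ) 1, N' u :=
    (lintegral_plus h hd hF₁m).trans (lintegral_minus h hd hF₁m).symm
  have hPP' : ∫⁻ u in Ioo (0 : ℝ) 1, P' u = ∫⁻ u in Ioo (0 : ℝ) 1, N u :=
    (lintegral_plus h hd hF₂m).trans (lintegral_minus h hd hF₂m).symm
  rw [lintegral_add_right (g := fun u => P u + N u) _ (hPm.add hNm),
    lintegral_add_right (g := fun u => P' u + N' u) _ (hPm'.add hNm'),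
    lintegral_add_left hPm, lintegral_add_left hPm', hPP', ← hPP] at key
  have hν : ∫⁻ u in Ioo (0 : ℝ) 1, B.indicator (1 : ℝ → ENNReal) (quantile ν u) = ν B := by
    rw [← lintegral_map hind (measurable_quantile ν), map_quantile, lintegral_indicator_one hB]
  rw [hν, add_comm (∫⁻ u in Ioo (0 : ℝ) 1, N u)] at key
  exact (ENNReal.add_left_inj (ENNReal.add_ne_top.2 ⟨hPfin, hNfin⟩)).1 key

/-- The mixtures have barycentre exactly a(u). In the Dirac branch a < b is excluded almost
everywhere, so b(u) ≤ a(u); unmatched points with a > b are the source of strict inequality. -/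
lemma ae_integral_mTilde_le (h : DcxPair μ ν) (hQ : IsQd μ ν Q)
    (hd : IsDisintegration μ ν Q πp πm) :
    ∀ᵐ u ∂(volume.restrict (Ioo (0 : ℝ) 1)), ∫ y, y ∂(mTilde μ ν πp πm u) ≤ quantile μ u := by
  filter_upwards [ae_restrict_mem measurableSet_Ioo,
    ae_restrict_of_ae (ae_minus_eq_one h hQ hd)] with u hu hminus
  unfold mTilde
  split_ifs with h1 h2
  · obtain ⟨h3, h4⟩ := straddles_plus hd.plus_le h1.1 h1.2.2
    exact h4.integrable_and_integral.2.le
  · obtain ⟨h3, h4⟩ := straddles_minus hd.minus_le h2.1 h2.2.2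
    exact h4.integrable_and_integral.2.le
  · rw [integral_dirac]
    exact not_lt.1 fun hlt => h2 ⟨hlt, hu, hminus hu hlt⟩

end Marginal

/-! ### From kernels on `(0,1)` to kernels on `ℝ` -/

section GrandM

variable {μ : Measure ℝ} {x u : ℝ}

lemma leftLim_cdf_nonneg (μ : Measure ℝ) (x : ℝ) : 0 ≤ Function.leftLim (cdf μ) x :=
  (cdf_nonneg μ (x - 1)).trans ((monotone_cdf μ).le_leftLim (sub_one_lt x))

lemma leftLim_cdf_le (μ : Measure ℝ) (x : ℝ) : Function.leftLim (cdf μ) x ≤ cdf μ x :=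
  (monotone_cdf μ).leftLim_le le_rfl

lemma leftLim_cdf_le_of_le_quantile (hu : u ∈ Ioo (0 : ℝ) 1) (h : x ≤ quantile μ u) :
    Function.leftLim (cdf μ) x ≤ u := by
  refine le_of_tendsto ((monotone_cdf μ).tendsto_leftLim x) ?_
  filter_upwards [self_mem_nhdsWithin] with y hy
  exact ((lt_quantile_iff hu).1 (lt_of_lt_of_le hy h)).le

lemma le_quantile_of_leftLim_lt (hu : u ∈ Ioo (0 : ℝ) 1) (h : Function.leftLim (cdf μ) x < u) :
    x ≤ quantile μ u := by
  by_contra hlt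
  have h1 := (quantile_le_iff hu).1 (le_refl (quantile μ u))
  exact absurd (h1.trans ((monotone_cdf μ).le_leftLim (not_le.1 hlt))) (not_le.2 h)

lemma not_degenerate_of_quantile (hu : u ∈ Ioo (0 : ℝ) 1) :
    ¬ (cdf μ (quantile μ u) = 0 ∨ Function.leftLim (cdf μ) (quantile μ u) = 1) := by
  rintro (h | h)
  · exact absurd (hu.1.trans_le ((quantile_le_iff (μ := μ) hu).1 le_rfl))
      (by simp [h])
  · exact absurd ((leftLim_cdf_le_of_le_quantile (μ := μ) hu le_rfl).trans_lt hu.2)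
      (by simp [h])

variable [IsProbabilityMeasure μ]

lemma measure_singleton_eq (μ : Measure ℝ) [IsProbabilityMeasure μ] (x : ℝ) :
    μ {x} = ENNReal.ofReal (cdf μ x - Function.leftLim (cdf μ) x) := by
  conv_lhs => rw [← measure_cdf μ]
  exact (cdf μ).measure_singleton x

lemma leftLim_eq_of_not_pos (h : ¬ 0 < μ {x}) : Function.leftLim (cdf μ) x = cdf μ x := by
  rw [measure_singleton_eq, ENNReal.ofReal_pos, not_lt, sub_nonpos] at h
  exact le_antisymm (leftLim_cdf_le μ x) h

lemma countable_atoms (μ : Measure ℝ) [IsProbabilityMeasure μ] : {x | 0 < μ {x}}.Countable := by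
  refine Countable.mono ?_ (cdf μ).countable_leftLim_ne
  intro x hx heq
  rw [mem_ofPred_eq, measure_singleton_eq, heq, sub_self, ENNReal.ofReal_zero] at hx
  exact hx.false

lemma preimage_quantile_singleton_ae_eq (μ : Measure ℝ) [IsProbabilityMeasure μ] (x : ℝ) :
    (quantile μ ⁻¹' {x} ∩ Ioo 0 1 : Set ℝ)
      =ᵐ[volume] Ioc (Function.leftLim (cdf μ) x) (cdf μ x) := by
  filter_upwards [Measure.ae_ne volume (Function.leftLim (cdf μ) x),
    Measure.ae_ne volume (1 : ℝ)] with u h1 h2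
  refine propext ⟨fun h => ?_, fun h => ?_⟩
  · exact ⟨lt_of_le_of_ne (leftLim_cdf_le_of_le_quantile h.2 (mem_singleton_iff.1 h.1).ge) h1.symm,
      (quantile_le_iff h.2).1 (mem_singleton_iff.1 h.1).le⟩
  · have hu : u ∈ Ioo (0 : ℝ) 1 := ⟨(leftLim_cdf_nonneg μ x).trans_lt h.1,
      lt_of_le_of_ne (h.2.trans (cdf_le_one μ x)) h2⟩
    exact ⟨le_antisymm ((quantile_le_iff hu).2 h.2) (le_quantile_of_leftLim_lt hu h.1), hu⟩

lemma not_degenerate_of_pos (hx : 0 < μ {x}) :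
    ¬ (cdf μ x = 0 ∨ Function.leftLim (cdf μ) x = 1) := by
  rw [measure_singleton_eq, ENNReal.ofReal_pos, sub_pos] at hx
  rintro (h | h)
  · exact absurd (h ▸ hx) (not_lt.2 (leftLim_cdf_nonneg μ x))
  · exact absurd (h ▸ hx) (not_lt.2 (cdf_le_one μ x))

lemma cdf_mem_of_not_pos (h1 : ¬ (cdf μ x = 0 ∨ Function.leftLim (cdf μ) x = 1))
    (h2 : ¬ 0 < μ {x}) : cdf μ x ∈ Ioo (0 : ℝ) 1 := by
  rw [leftLim_eq_of_not_pos h2, not_or] at h1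
  exact ⟨lt_of_le_of_ne (cdf_nonneg μ x) (Ne.symm h1.1), lt_of_le_of_ne (cdf_le_one μ x) h1.2⟩

lemma grandM_congr {mt mt' : ℝ → Measure ℝ} (h : ∀ u ∈ Ioo (0 : ℝ) 1, mt u = mt' u) (x : ℝ) :
    grandM μ mt x = grandM μ mt' x := by
  unfold grandM
  split_ifs with h1 h2
  · rfl
  · congr 1
    refine Measure.bind_congr_right ?_
    -- The jump interval may contain 1, which is outside (0,1) but negligible.
    filter_upwards [ae_restrict_mem measurableSet_Ioc,
      ae_restrict_of_ae (Measure.ae_ne volume (1 : ℝ))] with u hu hne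
    exact h u ⟨(leftLim_cdf_nonneg μ x).trans_lt hu.1,
      lt_of_le_of_ne (hu.2.trans (cdf_le_one μ x)) hne⟩
  · exact h _ (cdf_mem_of_not_pos h1 h2)

lemma measurable_grandM (k : Kernel ℝ ℝ) : Measurable (grandM μ k) := by
  classical
  have hbad : MeasurableSet {x | cdf μ x = 0 ∨ Function.leftLim (cdf μ) x = 1} :=
    ((monotone_cdf μ).measurable (measurableSet_singleton 0)).union
      ((monotone_cdf μ).leftLim.measurable (measurableSet_singleton 1))
  have h0 : Measurable fun x => if cdf μ x = 0 ∨ Function.leftLim (cdf μ) x = 1 then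
      Measure.dirac x else k (cdf μ x) :=
    Measurable.ite hbad Measure.measurable_dirac (k.measurable.comp (monotone_cdf μ).measurable)
  -- The averaging branch is used only at the countably many atoms, where values do not affect
  -- measurability.
  refine h0.measurable_of_countable_ne ((countable_atoms μ).mono fun x hx => ?_)
  by_contra hpos
  have hpos' : ¬ 0 < μ {x} := hpos
  refine hx ?_
  simp only [grandM, if_neg hpos']

lemma grandM_apply_of_pos (k : Kernel ℝ ℝ) (hx : 0 < μ {x}) {B : Set ℝ} (hB : MeasurableSet B) :
    grandM μ k x B
      = (μ {x})⁻¹ * ∫⁻ u in Ioc (Function.leftLim (cdf μ) x) (cdf μ x), k u B := by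
  rw [grandM, if_neg (not_degenerate_of_pos hx), if_pos hx, Measure.smul_apply, smul_eq_mul,
    Measure.bind_apply hB k.measurable.aemeasurable]

lemma isProbabilityMeasure_grandM (k : Kernel ℝ ℝ) [IsMarkovKernel k] (x : ℝ) :
    IsProbabilityMeasure (grandM μ k x) := by
  by_cases hpos : 0 < μ {x}
  · refine ⟨?_⟩
    rw [grandM_apply_of_pos k hpos MeasurableSet.univ]
    simp only [measure_univ, lintegral_one, Measure.restrict_apply MeasurableSet.univ, univ_inter]
    rw [Real.volume_Ioc, ← measure_singleton_eq]
    exact ENNReal.inv_mul_cancel hpos.ne' (measure_ne_top μ _)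
  · unfold grandM
    rw [if_neg hpos]
    split_ifs <;> infer_instance

/-- The kernel on `ℝ` associated with a Markov kernel on `(0,1)`. -/
noncomputable def grandKernel (μ : Measure ℝ) [IsProbabilityMeasure μ] (k : Kernel ℝ ℝ) :
    Kernel ℝ ℝ where
  toFun := grandM μ k
  measurable' := measurable_grandM k

lemma grandKernel_apply (k : Kernel ℝ ℝ) (x : ℝ) : grandKernel μ k x = grandM μ k x := rfl

instance (k : Kernel ℝ ℝ) [IsMarkovKernel k] : IsMarkovKernel (grandKernel μ k) :=
  ⟨fun x => isProbabilityMeasure_grandM k x⟩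

lemma setLIntegral_grandM_singleton (k : Kernel ℝ ℝ) [IsMarkovKernel k] (hx : 0 < μ {x})
    {B : Set ℝ} (hB : MeasurableSet B) :
    ∫⁻ u in quantile μ ⁻¹' {x}, k u B ∂(volume.restrict (Ioo 0 1))
      = ∫⁻ u in quantile μ ⁻¹' {x}, grandM μ k (quantile μ u) B ∂(volume.restrict (Ioo 0 1)) := by
  have hs : MeasurableSet (quantile μ ⁻¹' {x}) := measurable_quantile μ (measurableSet_singleton x)
  have e : ∫⁻ u in quantile μ ⁻¹' {x}, grandM μ k (quantile μ u) B ∂(volume.restrict (Ioo 0 1))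
      = ∫⁻ _ in quantile μ ⁻¹' {x}, grandM μ k x B ∂(volume.restrict (Ioo 0 1)) :=
    setLIntegral_congr_fun hs fun u hu => by rw [mem_singleton_iff.1 hu]
  rw [e, setLIntegral_const, Measure.restrict_restrict hs,
    Measure.restrict_congr_set (preimage_quantile_singleton_ae_eq μ x), Measure.restrict_apply hs,
    measure_congr (preimage_quantile_singleton_ae_eq μ x), Real.volume_Ioc, ← measure_singleton_eq,
    grandM_apply_of_pos k hx hB, mul_comm, ← mul_assoc,
    ENNReal.mul_inv_cancel hx.ne' (measure_ne_top μ _), one_mul]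

/-- Over an atom x the level set {a = x} is, up to a null set, the jump interval, on which averaging
preserves the integral. Elsewhere F_μ(a(u)) = u, so u is recovered from a(u) and nothing is
averaged. -/
lemma map_compProd_eq_compProd_grandKernel (k : Kernel ℝ ℝ) [IsMarkovKernel k] :
    (volume.restrict (Ioo (0 : ℝ) 1) ⊗ₘ k).map (fun p => (quantile μ p.1, p.2))
      = μ ⊗ₘ grandKernel μ k := by
  have hmap : Measurable fun p : ℝ × ℝ => (quantile μ p.1, p.2) :=
    ((measurable_quantile μ).comp measurable_fst).prodMk measurable_snd
  have : IsFiniteMeasure ((volume.restrict (Ioo (0 : ℝ) 1) ⊗ₘ k).map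
      (fun p => (quantile μ p.1, p.2))) := Measure.isFiniteMeasure_map _ _
  refine Measure.ext_prod fun {A B} hA hB => ?_
  have hpre : (fun p : ℝ × ℝ => (quantile μ p.1, p.2)) ⁻¹' (A ×ˢ B)
      = (quantile μ ⁻¹' A) ×ˢ B := rfl
  have hAm : MeasurableSet (quantile μ ⁻¹' A) := measurable_quantile μ hA
  rw [Measure.map_apply hmap (hA.prod hB), hpre, Measure.compProd_apply_prod hAm hB,
    Measure.compProd_apply_prod hA hB]
  have hrhs := setLIntegral_map (μ := volume.restrict (Ioo (0 : ℝ) 1)) hA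
    ((grandKernel μ k).measurable_coe hB) (measurable_quantile μ)
  rw [map_quantile] at hrhs
  rw [hrhs]
  simp only [grandKernel_apply]
  set D := {x | 0 < μ {x}} with hD
  have hDc : D.Countable := countable_atoms μ
  have hDm : MeasurableSet (quantile μ ⁻¹' D) := measurable_quantile μ hDc.measurableSet
  have hcA : (A ∩ D).Countable := hDc.mono inter_subset_right
  have hunion : quantile μ ⁻¹' A ∩ quantile μ ⁻¹' D
      = ⋃ x ∈ A ∩ D, quantile μ ⁻¹' {x} := by
    rw [← preimage_inter, ← biUnion_preimage_singleton]
  have hdisj : (A ∩ D).PairwiseDisjoint fun x => quantile μ ⁻¹' {x} := fun x _ y _ hxy =>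
    Disjoint.preimage _ (disjoint_singleton.2 hxy)
  have hms : ∀ x ∈ A ∩ D, MeasurableSet (quantile μ ⁻¹' {x}) := fun x _ =>
    measurable_quantile μ (measurableSet_singleton x)
  rw [← lintegral_inter_add_sdiff _ (quantile μ ⁻¹' A) hDm,
    ← lintegral_inter_add_sdiff (fun u => grandM μ k (quantile μ u) B) (quantile μ ⁻¹' A) hDm]
  congr 1
  · rw [hunion, lintegral_biUnion hcA hms hdisj, lintegral_biUnion hcA hms hdisj]
    exact tsum_congr fun x => setLIntegral_grandM_singleton k x.2.2 hB
  · rw [Measure.restrict_restrict (hAm.diff hDm)]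
    refine setLIntegral_congr_fun ((hAm.diff hDm).inter measurableSet_Ioo) fun u hu => ?_
    have hu01 := hu.2
    have hnp : ¬ 0 < μ {quantile μ u} := hu.1.2
    have hcdf : cdf μ (quantile μ u) = u := by
      refine le_antisymm ?_ ((quantile_le_iff hu01).1 le_rfl)
      rw [← leftLim_eq_of_not_pos hnp]
      exact leftLim_cdf_le_of_le_quantile hu01 le_rfl
    rw [grandM, if_neg (not_degenerate_of_quantile hu01), if_neg hnp, hcdf]

end GrandM

/-- A Markov kernel on `(0,1)` which transports Lebesgue measure to `ν` and whose barycentre at `u`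
is at most `F_μ⁻¹(u)` induces a supermartingale coupling. -/
lemma isSupermartingaleCoupling_grandKernel {μ ν : Measure ℝ} [IsProbabilityMeasure μ]
    [IsProbabilityMeasure ν] (hμ : Integrable (fun x : ℝ => x) μ)
    (hν : Integrable (fun x : ℝ => x) ν) (k : Kernel ℝ ℝ) [IsMarkovKernel k]
    (hk : ∀ B, MeasurableSet B → ∫⁻ u in Ioo (0 : ℝ) 1, k u B = ν B)
    (hle : ∀ᵐ u ∂(volume.restrict (Ioo (0 : ℝ) 1)), ∫ y, y ∂(k u) ≤ quantile μ u) :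
    IsSupermartingaleCoupling (μ ⊗ₘ grandKernel μ k) μ ν := by
  have hmap : Measurable fun p : ℝ × ℝ => (quantile μ p.1, p.2) :=
    ((measurable_quantile μ).comp measurable_fst).prodMk measurable_snd
  have hjoint := map_compProd_eq_compProd_grandKernel (μ := μ) k
  have hsnd' : (volume.restrict (Ioo (0 : ℝ) 1) ⊗ₘ k).map Prod.snd = ν := by
    ext B hB
    have : (Prod.snd ⁻¹' B : Set (ℝ × ℝ)) = univ ×ˢ B := by ext; simp
    rw [Measure.map_apply measurable_snd hB, this,
      Measure.compProd_apply_prod MeasurableSet.univ hB, Measure.restrict_univ, hk B hB]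
  have hsnd : (μ ⊗ₘ grandKernel μ k).map Prod.snd = ν := by
    rw [← hjoint, Measure.map_map measurable_snd hmap]
    exact hsnd'
  have hi : Integrable (fun p : ℝ × ℝ => p.2) (μ ⊗ₘ grandKernel μ k) := by
    rw [← hsnd] at hν
    exact (integrable_map_measure aestronglyMeasurable_id measurable_snd.aemeasurable).1 hν
  have hi' : Integrable (fun p : ℝ × ℝ => p.2) (volume.restrict (Ioo (0 : ℝ) 1) ⊗ₘ k) := by
    rw [← hsnd'] at hν
    exact (integrable_map_measure aestronglyMeasurable_id measurable_snd.aemeasurable).1 hν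
  have him : Integrable (fun x => ∫ y, y ∂(grandKernel μ k x)) μ := by
    simpa using Integrable.integral_compProd (κ := Kernel.const Unit μ)
      (η := Kernel.prodMkLeft Unit (grandKernel μ k)) (a := ()) hi
  have hik : Integrable (fun u => ∫ y, y ∂(k u)) (volume.restrict (Ioo (0 : ℝ) 1)) := by
    simpa using Integrable.integral_compProd (κ := Kernel.const Unit (volume.restrict (Ioo 0 1)))
      (η := Kernel.prodMkLeft Unit k) (a := ()) hi'
  refine ⟨⟨Measure.fst_compProd _ _, hsnd⟩, grandKernel μ k, inferInstance, rfl, ?_⟩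
  have hae : ∀ᵐ x ∂μ, Integrable (fun y : ℝ => y) (grandKernel μ k x) :=
    ((Measure.integrable_compProd_iff hi.aestronglyMeasurable).1 hi).1
  have hmean : (fun x => ∫ y, y ∂(grandKernel μ k x)) ≤ᵐ[μ] fun x => x := by
    -- The barycentre at x is a conditional expectation given a(u) = x. The inequality is therefore
    -- tested on sets A, where both sides become integrals over {a ∈ A} in (0,1).
    refine ae_le_of_forall_setIntegral_le him hμ fun A hA _ => ?_
    have hAm : MeasurableSet (quantile μ ⁻¹' A) := measurable_quantile μ hA
    have e1 : ∫ x in A, ∫ y, y ∂(grandKernel μ k x) ∂μ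
        = ∫ p in A ×ˢ univ, p.2 ∂(μ ⊗ₘ grandKernel μ k) := by
      rw [Measure.setIntegral_compProd hA MeasurableSet.univ hi.integrableOn]
      simp
    have e2 : ∫ p in A ×ˢ univ, p.2 ∂(μ ⊗ₘ grandKernel μ k)
        = ∫ u in quantile μ ⁻¹' A, ∫ y, y ∂(k u) ∂(volume.restrict (Ioo (0 : ℝ) 1)) := by
      rw [← hjoint, setIntegral_map (hA.prod MeasurableSet.univ)
        measurable_snd.aestronglyMeasurable hmap.aemeasurable]
      change ∫ p in (quantile μ ⁻¹' A) ×ˢ univ, p.2 ∂(volume.restrict (Ioo (0 : ℝ) 1) ⊗ₘ k) = _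
      rw [Measure.setIntegral_compProd hAm MeasurableSet.univ hi'.integrableOn]
      simp
    have e3 : ∫ x in A, x ∂μ
        = ∫ u in quantile μ ⁻¹' A, quantile μ u ∂(volume.restrict (Ioo (0 : ℝ) 1)) := by
      conv_lhs => rw [← map_quantile μ]
      rw [setIntegral_map (f := fun x : ℝ => x) hA aestronglyMeasurable_id
        (measurable_quantile μ).aemeasurable]
    rw [e1, e2, e3]
    exact integral_mono_ae hik.integrableOn (integrable_quantile hμ).integrableOn
      (ae_restrict_of_ae hle)
  filter_upwards [hae, hmean] with x h1 h2 using ⟨h1, h2⟩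

/-! ### Disintegrations -/

/-- Restricting the conditional kernel to s forces the support condition at every point rather than
almost everywhere; the possible loss of mass, confined to a null set, is why the kernels are only
sub-Markov. -/
lemma exists_subMarkov_disintegration (P : Measure (ℝ × ℝ)) [IsProbabilityMeasure P] {s : Set ℝ}
    (hs : MeasurableSet s) (hP : ∀ᵐ p ∂P, p.2 ∈ s) :
    ∃ π : Kernel ℝ ℝ, (∀ u, π u univ ≤ 1) ∧ (∀ u, π u sᶜ = 0) ∧ P = P.map Prod.fst ⊗ₘ π := by
  refine ⟨P.condKernel.restrict hs, fun u => ?_, fun u => ?_, ?_⟩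
  · rw [Kernel.restrict_apply]
    exact (Measure.restrict_apply_univ s).le.trans prob_le_one
  · rw [Kernel.restrict_apply, Measure.restrict_apply hs.compl]
    simp
  · have hdis : P.fst ⊗ₘ P.condKernel = P := P.disintegrate P.condKernel
    conv_lhs => rw [← hdis]
    refine Measure.compProd_congr ?_
    have hP' : ∀ᵐ p ∂(P.fst ⊗ₘ P.condKernel), p.2 ∈ s := by rwa [hdis]
    filter_upwards [Measure.ae_ae_of_ae_compProd hP'] with u hu
    rw [Kernel.restrict_apply]
    exact (Measure.restrict_eq_self_of_ae_mem hu).symm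

section

variable {μ ν : Measure ℝ} {Q : Measure (ℝ × ℝ)} {u v : ℝ}

lemma IsQd.exists_isDisintegration (h : DcxPair μ ν) (hQ : IsQd μ ν Q) :
    ∃ πp πm : Kernel ℝ ℝ, IsDisintegration μ ν Q πp πm := by
  have := hQ.prob
  have hae := hQ.ae_lt h
  have : IsProbabilityMeasure (Q.map Prod.swap) :=
    Measure.isProbabilityMeasure_map measurable_swap.aemeasurable
  obtain ⟨πp, hp1, hp2, hp3⟩ := exists_subMarkov_disintegration Q measurableSet_Ioo
    (hae.mono fun p hp => hp.1.2)
  obtain ⟨πm, hm1, hm2, hm3⟩ := exists_subMarkov_disintegration (Q.map Prod.swap)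
    (s := Ioo 0 (uD μ ν)) measurableSet_Ioo
    ((ae_map_iff measurable_swap.aemeasurable (measurable_snd measurableSet_Ioo)).2
      (hae.mono fun p hp => hp.1.1))
  have hfst : (Q.map Prod.swap).map Prod.fst = rhoMinus μ ν := by
    rw [Measure.map_map measurable_fst measurable_swap, ← hQ.snd_eq]
    rfl
  rw [hQ.fst_eq] at hp3
  rw [hfst] at hm3
  refine ⟨πp, πm, hp1, hp2, hm1, hm2, hp3, ?_⟩
  rw [← hm3, Measure.map_map measurable_swap measurable_swap, Prod.swap_swap_eq, Measure.map_id]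

/-- The kernel `m̃` built from disintegration kernels. -/
noncomputable def mTildeKernel (μ ν : Measure ℝ) {Q : Measure (ℝ × ℝ)} {πp πm : Kernel ℝ ℝ}
    (hd : IsDisintegration μ ν Q πp πm) : Kernel ℝ ℝ where
  toFun := mTilde μ ν πp πm
  measurable' := measurable_mTilde hd.plus_le hd.minus_le

lemma exists_supermartingaleCoupling (h : DcxPair μ ν) (hQ : IsQd μ ν Q) {πp πm : Kernel ℝ ℝ}
    (hd : IsDisintegration μ ν Q πp πm) :
    ∃ m : Kernel ℝ ℝ, IsMarkovKernel m ∧ (∀ x, m x = grandM μ (mTilde μ ν πp πm) x) ∧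
      IsSupermartingaleCoupling (μ ⊗ₘ m) μ ν := by
  have := h.prob_left
  have := h.prob_right
  have : IsMarkovKernel (mTildeKernel μ ν hd) :=
    ⟨fun u => isProbabilityMeasure_mTilde hd.plus_le hd.minus_le u⟩
  exact ⟨grandKernel μ (mTildeKernel μ ν hd), inferInstance, fun x => rfl,
    isSupermartingaleCoupling_grandKernel h.integrable_left h.integrable_right _
      (fun B hB => lintegral_mTilde h hQ hd hB) (ae_integral_mTilde_le h hQ hd)⟩

/-! ### The inverse transform supermartingale coupling -/

/-- The kernel `π₊^{ITS}`. -/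
noncomputable def DcxPair.kernelITSPlus (h : DcxPair μ ν) : Kernel ℝ ℝ where
  toFun := piITSPlus μ ν
  measurable' := by
    classical
    have hs : MeasurableSet {u | u ∈ Ioo 0 (uD μ ν) ∧ 0 < phi μ ν u ∧ phi μ ν u < 1} :=
      measurableSet_Ioo.inter (h.measurable_phi measurableSet_Ioo)
    exact Measurable.ite hs (Measure.measurable_dirac.comp h.measurable_phi) measurable_const

/-- The kernel `π₋^{ITS}`. -/
noncomputable def DcxPair.kernelITSMinus (h : DcxPair μ ν) : Kernel ℝ ℝ where
  toFun := piITSMinus μ ν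
  measurable' := by
    classical
    have hs : MeasurableSet
        {v | v ∈ Ioo (0 : ℝ) 1 ∧ 0 < phiTilde μ ν v ∧ phiTilde μ ν v < uD μ ν} :=
      measurableSet_Ioo.inter (h.measurable_phiTilde measurableSet_Ioo)
    exact Measurable.ite hs (Measure.measurable_dirac.comp h.measurable_phiTilde) measurable_const

lemma DcxPair.isDisintegration_ITS (h : DcxPair μ ν) :
    IsDisintegration μ ν (QITS μ ν) h.kernelITSPlus h.kernelITSMinus := by
  have := h.isProbabilityMeasure_rhoPlus
  have := h.isProbabilityMeasure_rhoMinus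
  have hp1 : ∀ u, piITSPlus μ ν u univ ≤ 1 := fun u => by
    unfold piITSPlus; split_ifs <;> simp
  have hm1 : ∀ u, piITSMinus μ ν u univ ≤ 1 := fun u => by
    unfold piITSMinus; split_ifs <;> simp
  have : IsFiniteKernel h.kernelITSPlus := ⟨⟨1, ENNReal.one_lt_top, hp1⟩⟩
  have : IsFiniteKernel h.kernelITSMinus := ⟨⟨1, ENNReal.one_lt_top, hm1⟩⟩
  refine ⟨hp1, fun u => ?_, hm1, fun v => ?_, ?_, ?_⟩
  · change piITSPlus μ ν u _ = 0
    unfold piITSPlus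
    split_ifs with hu
    · rw [Measure.dirac_apply, indicator_of_notMem (not_not.2 hu.2)]
    · simp
  · change piITSMinus μ ν v _ = 0
    unfold piITSMinus
    split_ifs with hv
    · rw [Measure.dirac_apply, indicator_of_notMem (not_not.2 hv.2)]
    · simp
  · rw [h.QITS_eq, ← Measure.compProd_deterministic h.measurable_phi]
    refine Measure.compProd_congr ?_
    filter_upwards [ae_rhoPlus_mem μ ν, h.ae_phi_mem] with u h1 h2
    rw [Kernel.deterministic_apply]
    exact (if_pos (c := u ∈ Ioo 0 (uD μ ν) ∧ 0 < phi μ ν u ∧ phi μ ν u < 1) ⟨h1, h2⟩).symm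
  · have e : rhoMinus μ ν ⊗ₘ h.kernelITSMinus = (rhoMinus μ ν).map fun v => (v, phiTilde μ ν v) := by
      rw [← Measure.compProd_deterministic h.measurable_phiTilde]
      refine Measure.compProd_congr ?_
      filter_upwards [ae_rhoMinus_mem μ ν, h.ae_phiTilde_mem] with v h1 h2
      rw [Kernel.deterministic_apply]
      exact if_pos (c := v ∈ Ioo (0 : ℝ) 1 ∧ 0 < phiTilde μ ν v ∧ phiTilde μ ν v < uD μ ν) ⟨h1, h2⟩
    rw [e, h.QITS_eq_swap, Measure.map_map (f := fun v => (v, phiTilde μ ν v)) measurable_swap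
      (measurable_id.prodMk h.measurable_phiTilde)]
    rfl

lemma mixture_dirac (μ ν : Measure ℝ) (u v : ℝ) :
    mixture μ ν u (Measure.dirac v)
      = ENNReal.ofReal ((quantile ν v - quantile μ u) / (quantile ν v - quantile ν u))
          • Measure.dirac (quantile ν u)
        + ENNReal.ofReal (weight μ ν u v) • Measure.dirac (quantile ν v) := by
  ext B hB
  rw [mixture_apply hB, lintegral_dirac, lintegral_dirac, add_comm, Measure.add_apply,
    Measure.smul_apply, Measure.smul_apply, Measure.dirac_apply' _ hB, Measure.dirac_apply' _ hB,
    smul_eq_mul, smul_eq_mul]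

lemma dirac_apply_eq_one_iff {s : Set ℝ} : Measure.dirac u s = 1 ↔ u ∈ s := by
  classical
  rw [Measure.dirac_apply, indicator_apply]
  split_ifs with hu <;> simp [hu]

/-- A Dirac mass charges a set fully exactly when its point lies there. The condition 0 < φ(u) is
absent on the right because u < φ(u) already holds when a > b. -/
lemma DcxPair.piITSPlus_eq_one_iff (h : DcxPair μ ν) (hu : u ∈ Ioo (0 : ℝ) 1) :
    (quantile ν u < quantile μ u ∧ u ∈ Ioo 0 (uD μ ν) ∧
      piITSPlus μ ν u {v | v ∈ Ioo (0 : ℝ) 1 ∧ quantile μ u < quantile ν v} = 1) ↔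
    (u < uD μ ν ∧ quantile μ u < quantile ν (phi μ ν u) ∧ quantile ν u < quantile μ u ∧
      phi μ ν u < 1) := by
  constructor
  · rintro ⟨h1, h2, h3⟩
    unfold piITSPlus at h3
    split_ifs at h3 with hc
    · exact ⟨h2.2, (dirac_apply_eq_one_iff.1 h3).2, h1, hc.2.2⟩
    · simp at h3
  · rintro ⟨h1, h2, h3, h4⟩
    have hmem : u ∈ Ioo 0 (uD μ ν) := ⟨hu.1, h1⟩
    have hpos : 0 < phi μ ν u := hu.1.trans (h.lt_phi hmem h3)
    refine ⟨h3, hmem, ?_⟩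
    rw [piITSPlus, if_pos ⟨hmem, hpos, h4⟩]
    exact dirac_apply_eq_one_iff.2 ⟨⟨hpos, h4⟩, h2⟩

/-- Here 0 < φ̃(u) can be dropped because a(u) < b(u) makes Ψ₋(u) positive. -/
lemma DcxPair.piITSMinus_eq_one_iff (h : DcxPair μ ν) (hu : u ∈ Ioo (0 : ℝ) 1) :
    (quantile μ u < quantile ν u ∧ u ∈ Ioo (0 : ℝ) 1 ∧
      piITSMinus μ ν u {v | v ∈ Ioo (0 : ℝ) 1 ∧ quantile ν v < quantile μ u} = 1) ↔
    (quantile ν (phiTilde μ ν u) < quantile μ u ∧ quantile μ u < quantile ν u ∧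
      phiTilde μ ν u < uD μ ν) := by
  constructor
  · rintro ⟨h1, -, h3⟩
    unfold piITSMinus at h3
    split_ifs at h3 with hc
    · exact ⟨(dirac_apply_eq_one_iff.1 h3).2, h1, hc.2.2⟩
    · simp at h3
  · rintro ⟨h1, h2, h3⟩
    have hpos : 0 < phiTilde μ ν u := h.phiTilde_pos hu h2
    refine ⟨h2, hu, ?_⟩
    rw [piITSMinus, if_pos ⟨hu, hpos, h3⟩]
    exact dirac_apply_eq_one_iff.2 ⟨⟨hpos, h3.trans_le h.uD_mem.2⟩, h1⟩

lemma DcxPair.mTilde_ITS (h : DcxPair μ ν) (hu : u ∈ Ioo (0 : ℝ) 1) :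
    mTilde μ ν h.kernelITSPlus h.kernelITSMinus u = mTildeITS μ ν u := by
  have h1 := h.piITSPlus_eq_one_iff hu
  have h2 := h.piITSMinus_eq_one_iff hu
  unfold mTilde mTildeITS
  refine ite_congr (propext h1) (fun hc => ?_) fun _ => ite_congr (propext h2) (fun hc => ?_) fun _ => rfl
  · have hpos : quantile ν (phi μ ν u) - quantile ν u ≠ 0 := by linarith [hc.2.1, hc.2.2.1]
    have e : h.kernelITSPlus u = Measure.dirac (phi μ ν u) :=
      if_pos ⟨⟨hu.1, hc.1⟩, hu.1.trans (h.lt_phi ⟨hu.1, hc.1⟩ hc.2.2.1), hc.2.2.2⟩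
    have e' : (quantile ν (phi μ ν u) - quantile μ u) / (quantile ν (phi μ ν u) - quantile ν u)
        = 1 - (quantile μ u - quantile ν u) / (quantile ν (phi μ ν u) - quantile ν u) := by
      field_simp
      ring
    rw [e, mixture_dirac, weight, e']
  · have hneg : quantile ν (phiTilde μ ν u) - quantile ν u ≠ 0 := by linarith [hc.1, hc.2.1]
    have hneg' : quantile ν u - quantile ν (phiTilde μ ν u) ≠ 0 := by linarith [hc.1, hc.2.1]
    have e : h.kernelITSMinus u = Measure.dirac (phiTilde μ ν u) :=
      if_pos ⟨hu, h.phiTilde_pos hu hc.2.1, hc.2.2⟩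
    have e1 : weight μ ν u (phiTilde μ ν u)
        = (quantile ν u - quantile μ u) / (quantile ν u - quantile ν (phiTilde μ ν u)) := by
      rw [weight, ← neg_div_neg_eq, neg_sub, neg_sub]
    have e2 : (quantile ν (phiTilde μ ν u) - quantile μ u)
          / (quantile ν (phiTilde μ ν u) - quantile ν u)
        = 1 - (quantile ν u - quantile μ u) / (quantile ν u - quantile ν (phiTilde μ ν u)) := by
      rw [← neg_div_neg_eq, neg_sub, neg_sub]
      field_simp
      ring
    rw [e, mixture_dirac, e1, e2]

end

lemma DcxPair.exists_grandM_ITS {μ ν : Measure ℝ} (h : DcxPair μ ν) :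
    ∃ m : Kernel ℝ ℝ, IsMarkovKernel m ∧ (∀ x, m x = grandM μ (mTildeITS μ ν) x) ∧
      IsSupermartingaleCoupling (μ ⊗ₘ m) μ ν := by
  have := h.prob_left
  obtain ⟨m, hm, hmx, hs⟩ := exists_supermartingaleCoupling h h.QITS_mem h.isDisintegration_ITS
  exact ⟨m, hm, fun x => (hmx x).trans (grandM_congr (fun u hu => h.mTilde_ITS hu) x), hs⟩

/-! ### Reflection -/

section Reflect

variable {μ ν : Measure ℝ}

lemma reflect_reflect (μ : Measure ℝ) : reflect (reflect μ) = μ := by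
  rw [reflect, reflect, Measure.map_map measurable_neg measurable_neg]
  simp

lemma isProbabilityMeasure_reflect (μ : Measure ℝ) [IsProbabilityMeasure μ] :
    IsProbabilityMeasure (reflect μ) :=
  Measure.isProbabilityMeasure_map measurable_neg.aemeasurable

lemma integrable_reflect (hμ : Integrable (fun x : ℝ => x) μ) :
    Integrable (fun x : ℝ => x) (reflect μ) :=
  (integrable_map_measure aestronglyMeasurable_id measurable_neg.aemeasurable).2 hμ.neg

lemma integral_reflect (μ : Measure ℝ) : ∫ y, y ∂(reflect μ) = -∫ y, y ∂μ := by
  rw [reflect, integral_map (f := fun y : ℝ => y) measurable_neg.aemeasurable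
    aestronglyMeasurable_id, integral_neg]

lemma IcxLE.dcxLE_reflect (h : IcxLE μ ν) : DcxLE (reflect μ) (reflect ν) := by
  intro f hf hconv hint
  have hfm : Measurable f := hf.measurable
  have hneg : Measurable fun x : ℝ => -x := measurable_neg
  have hmono : Monotone fun x => f (-x) := fun x y hxy => hf (neg_le_neg hxy)
  have hconv' : ConvexOn ℝ univ fun x => f (-x) :=
    hconv.comp_linearMap (-LinearMap.id : ℝ →ₗ[ℝ] ℝ)
  have hint' : Integrable (fun x => f (-x)) ν :=
    (integrable_map_measure hfm.aestronglyMeasurable hneg.aemeasurable).1 hint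
  obtain ⟨h1, h2⟩ := h _ hmono hconv' hint'
  refine ⟨(integrable_map_measure hfm.aestronglyMeasurable hneg.aemeasurable).2 h1, ?_⟩
  rw [reflect, reflect, integral_map hneg.aemeasurable hfm.aestronglyMeasurable,
    integral_map hneg.aemeasurable hfm.aestronglyMeasurable]
  exact h2

/-- The kernel `x ↦ reflect (m (-x))`. -/
noncomputable def reflectKernel (m : Kernel ℝ ℝ) : Kernel ℝ ℝ :=
  (m.comap (fun x : ℝ => -x) measurable_neg).map fun x => -x

lemma reflectKernel_apply (m : Kernel ℝ ℝ) (x : ℝ) : reflectKernel m x = reflect (m (-x)) := by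
  rw [reflectKernel, Kernel.map_apply _ measurable_neg, Kernel.comap_apply, reflect]

lemma isMarkovKernel_reflectKernel (m : Kernel ℝ ℝ) [IsMarkovKernel m] :
    IsMarkovKernel (reflectKernel m) :=
  ⟨fun x => by rw [reflectKernel_apply]; exact isProbabilityMeasure_reflect _⟩

lemma reflect₂_compProd [IsProbabilityMeasure μ] (m : Kernel ℝ ℝ) [IsMarkovKernel m] :
    reflect₂ (reflect μ ⊗ₘ m) = μ ⊗ₘ reflectKernel m := by
  have := isProbabilityMeasure_reflect μ
  have := isMarkovKernel_reflectKernel m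
  have hneg : Measurable fun p : ℝ × ℝ => (-p.1, -p.2) := by fun_prop
  ext s hs
  rw [reflect₂, Measure.map_apply hneg hs, Measure.compProd_apply (hneg hs),
    Measure.compProd_apply hs, reflect, lintegral_map
      (Kernel.measurable_kernel_prodMk_left (hneg hs)) measurable_neg]
  refine lintegral_congr fun x => ?_
  rw [reflectKernel_apply, reflect, Measure.map_apply measurable_neg (measurable_prodMk_left hs)]
  congr 1
  ext y
  simp

lemma IsSupermartingaleCoupling.reflect₂ [IsProbabilityMeasure μ] {M : Measure (ℝ × ℝ)}
    (h : IsSupermartingaleCoupling M (reflect μ) (reflect ν)) :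
    IsSubmartingaleCoupling (reflect₂ M) μ ν := by
  have hneg : Measurable fun p : ℝ × ℝ => (-p.1, -p.2) := by fun_prop
  obtain ⟨m, hm, hM, hae⟩ := h.exists_kernel
  refine ⟨⟨?_, ?_⟩, reflectKernel m, isMarkovKernel_reflectKernel m, ?_, ?_⟩
  · rw [← reflect_reflect μ, ← h.fst_eq, ITCoupling.reflect₂, ITCoupling.reflect,
      Measure.map_map measurable_fst hneg, Measure.map_map measurable_neg measurable_fst]
    rfl
  · rw [← reflect_reflect ν, ← h.snd_eq, ITCoupling.reflect₂, ITCoupling.reflect,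
      Measure.map_map measurable_snd hneg, Measure.map_map measurable_neg measurable_snd]
    rfl
  · rw [hM]
    exact reflect₂_compProd m
  · filter_upwards [ae_of_ae_map measurable_neg.aemeasurable hae] with x hx
    rw [reflectKernel_apply]
    refine ⟨integrable_reflect hx.1, ?_⟩
    rw [integral_reflect]
    linarith [hx.2]

end Reflect

end ITCoupling

theorem mainTheorem10 (μ ν : Measure ℝ) [IsProbabilityMeasure μ] [IsProbabilityMeasure ν]
    (hμ : Integrable (fun x : ℝ => x) μ) (hν : Integrable (fun x : ℝ => x) ν) :
    -- decreasing convex order: supermartingale couplings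
    (DcxLE μ ν → 0 < uD μ ν →
      -- every element of `𝒬^d` can be disintegrated, and every choice of the disintegration
      -- kernels gives a supermartingale coupling
      (∀ Q ∈ Qd μ ν,
        (∃ πp πm : Kernel ℝ ℝ, IsDisintegration μ ν Q πp πm) ∧
        ∀ πp πm : Kernel ℝ ℝ, IsDisintegration μ ν Q πp πm →
          ∃ m : Kernel ℝ ℝ, IsMarkovKernel m ∧
            (∀ x, m x = grandM μ (mTilde μ ν πp πm) x) ∧
            IsSupermartingaleCoupling (μ ⊗ₘ m) μ ν) ∧
      -- the inverse transform supermartingale coupling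
      QITS μ ν ∈ Qd μ ν ∧
      ∃ πp πm : Kernel ℝ ℝ,
        (∀ u, πp u = piITSPlus μ ν u) ∧ (∀ v, πm v = piITSMinus μ ν v) ∧
        IsDisintegration μ ν (QITS μ ν) πp πm ∧
        (∀ u ∈ Ioo (0 : ℝ) 1, mTilde μ ν πp πm u = mTildeITS μ ν u) ∧
        ∃ m : Kernel ℝ ℝ, IsMarkovKernel m ∧
          (∀ x, m x = grandM μ (mTildeITS μ ν) x) ∧
          IsSupermartingaleCoupling (μ ⊗ₘ m) μ ν) ∧
    -- increasing convex order: submartingale couplings by reflection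
    (IcxLE μ ν →
      DcxLE (reflect μ) (reflect ν) ∧
      (∀ M : Measure (ℝ × ℝ), IsSupermartingaleCoupling M (reflect μ) (reflect ν) →
        IsSubmartingaleCoupling (reflect₂ M) μ ν) ∧
      (0 < uD (reflect μ) (reflect ν) →
        (∀ Q ∈ Qd (reflect μ) (reflect ν), ∀ πp πm : Kernel ℝ ℝ,
          IsDisintegration (reflect μ) (reflect ν) Q πp πm →
          ∃ m : Kernel ℝ ℝ, IsMarkovKernel m ∧
            (∀ x, m x = grandM (reflect μ) (mTilde (reflect μ) (reflect ν) πp πm) x) ∧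
            IsSubmartingaleCoupling (reflect₂ (reflect μ ⊗ₘ m)) μ ν) ∧
        ∃ m : Kernel ℝ ℝ, IsMarkovKernel m ∧
          (∀ x, m x = grandM (reflect μ) (mTildeITS (reflect μ) (reflect ν)) x) ∧
          IsSubmartingaleCoupling (reflect₂ (reflect μ ⊗ₘ m)) μ ν)) := by
  refine ⟨fun hdcx hpos => ?_, fun hicx => ?_⟩
  · have h : DcxPair μ ν := ⟨inferInstance, inferInstance, hμ, hν, hdcx, hpos⟩
    exact ⟨fun Q hQ => ⟨IsQd.exists_isDisintegration h hQ, fun πp πm hd =>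
      exists_supermartingaleCoupling h hQ hd⟩, h.QITS_mem, h.kernelITSPlus, h.kernelITSMinus,
      fun _ => rfl, fun _ => rfl, h.isDisintegration_ITS, fun u hu => h.mTilde_ITS hu,
      h.exists_grandM_ITS⟩
  · have hdcx := hicx.dcxLE_reflect
    refine ⟨hdcx, fun M hM => hM.reflect₂, fun hpos => ?_⟩
    have h : DcxPair (reflect μ) (reflect ν) := ⟨isProbabilityMeasure_reflect μ,
      isProbabilityMeasure_reflect ν, integrable_reflect hμ, integrable_reflect hν, hdcx, hpos⟩
    refine ⟨fun Q hQ πp πm hd => ?_, ?_⟩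
    · obtain ⟨m, hm, hmx, hs⟩ := exists_supermartingaleCoupling h hQ hd
      exact ⟨m, hm, hmx, hs.reflect₂⟩
    · obtain ⟨m, hm, hmx, hs⟩ := h.exists_grandM_ITS
      exact ⟨m, hm, hmx, hs.reflect₂⟩
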